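/- Let $a>0$, $M>0$, and let $\Omega=\{u=(\rho,q)\in\mathbb R^2:\rho>0\}$ be the phase space of the isothermal gas system $\rho_t+q_x=0$, $q_t+(q^2/\rho+a^2\rho)_x=0$, with pressure $p(\rho)=a^2\rho$. For $u\in\Omega$ put $v=q/\rho$, $\lambda_1(u)=v-a$, $\lambda_2(u)=v+a$, $w(u)=\frac{q}{a\rho}+\log\rho$, $z(u)=\frac{q}{a\rho}-\log\rho$. *Lax curves and the Lax solver.* For $u_*\in\Omega$ and $\rho>0$ let $$\mathcal{FL}_1(\rho,u_*)=\begin{cases}\rho\left[v_*-a\log(\rho/\rho_*)\right]&\rho\le\rho_*,\\ \rho\left[v_*-a\left(\sqrt{\rho/\rho_*}-\sqrt{\rho_*/\rho}\right)\right]&\rho>\rho_*,\end{cases}\qquad \mathcal{BL}_2(\rho,u_*)=\begin{cases}\rho\left[v_*+a\log(\rho/\rho_*)\right]&\rho\le\rho_*,\\ \rho\left[v_*+a\left(\sqrt{\rho/\rho_*}-\sqrt{\rho_*/\rho}\right)\right]&\rho>\rho_*.\end{cases}$$ Let $\tilde u=\tilde u(u_\ell,u_r)$ be the unique common point of the graphs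 of $\mathcal{FL}_1(\cdot,u_\ell)$ and $\mathcal{BL}_2(\cdot,u_r)$; let $\hat u(u_*)$, resp. $\check u(u_*)$, be the intersection of the graph of $\mathcal{FL}_1(\cdot,u_*)$, resp. $\mathcal{BL}_2(\cdot,u_*)$, with the line $q=0$ that has the largest density; write $\hat u_\ell=\hat u(u_\ell)$, $\hat p_\ell=p(\hat\rho_\ell)$, $\check u_r=\check u(u_r)$, $\check p_r=p(\check\rho_r)$. The Lax Riemann solver $\mathcal{RS}_{\rm p}:\Omega^2\to BV(\mathbb R;\Omega)$ maps $(u_\ell,u_r)$ to the right-continuous self-similar profile $u_{\rm p}(\xi)$, $\xi=x/t$, made of a wave of the first family from $u_\ell$ to $\tilde u$ (a shock if $\tilde\rho>\rho_\ell$, a possibly null rarefaction otherwise) followed by a wave of the second family from $\tilde u$ to $u_r$ (a shock if $\rho_r<\tilde\rho$, a possibly null rarefaction otherwise). A shock between $u$ and $u'$ has speed $(q-q')/(\rho-\rho')$; an $i$-rarefaction from $u$ to $u'$ occupies $\lambda_i(u)\le\xi\le\lambda_i(u')$, with $\lambda_i=\xi$ at $\xi$ and with $w$ (if $i=1$) or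 $z$ (if $i=2$) constant. Put $u_{\rm p}^\pm=u_{\rm p}(0^\pm)$. *The valve.* Let $\mathsf A=\{(u_\ell,u_r)\in\Omega^2:|\check p_r-\hat p_\ell|\le M\}$ and $\mathsf O=\Omega^2\setminus\mathsf A$. The two-way electronic pressure valve is the solver $u_{\rm v}=\mathcal{RS}_{\rm v}[u_\ell,u_r]$ on $\mathsf D=\Omega^2$ given by $\mathcal{RS}_{\rm v}[u_\ell,u_r]=\mathcal{RS}_{\rm p}[u_\ell,u_r]$ on $\mathsf O$ and, on $\mathsf A$, by $\mathcal{RS}_{\rm v}[u_\ell,u_r](\xi)=\mathcal{RS}_{\rm p}[u_\ell,\hat u_\ell](\xi)$ for $\xi<0$ and $=\mathcal{RS}_{\rm p}[\check u_r,u_r](\xi)$ for $\xi\ge0$. Let $\mathsf A_{\mathsf N}=\{(u_\ell,u_r)\in\mathsf A:u_{\rm v}\equiv u_{\rm p}\}$, $\mathsf A_{\mathsf I}=\mathsf A\setminus\mathsf A_{\mathsf N}$, $\mathsf A_{\mathsf I}^{\complement}=\Omega^2\setminus\mathsf A_{\mathsf I}$. *Properties.* Let $\mathcal{RS}$ be a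 solver on $\mathsf D$ and let $u=\mathcal{RS}[u_\ell,u_r]$ for $(u_\ell,u_r)\in\mathsf D$. The coherence domain $\mathsf{CH}$ is the set of $(u_\ell,u_r)\in\mathsf D$ such that $(u(0^-),u(0^+))\in\mathsf D$ and $\mathcal{RS}[u(0^-),u(0^+)]$ equals $u(0^-)$ for $\xi<0$ and $u(0^+)$ for $\xi\ge0$. The consistence domain $\mathsf{CN}$ is the set of $(u_\ell,u_r)\in\mathsf D$ such that for every $\xi_o\in\mathbb R$: $(u_\ell,u(\xi_o)),(u(\xi_o),u_r)\in\mathsf D$; $\mathcal{RS}[u_\ell,u(\xi_o)]$ equals $u(\xi)$ for $\xi<\xi_o$ and $u(\xi_o)$ for $\xi\ge\xi_o$; $\mathcal{RS}[u(\xi_o),u_r]$ equals $u(\xi_o)$ for $\xi<\xi_o$ and $u(\xi)$ for $\xi\ge\xi_o$; and $u(\xi)$ equals $\mathcal{RS}[u_\ell,u(\xi_o)](\xi)$ for $\xi<\xi_o$ and $\mathcal{RS}[u(\xi_o),u_r](\xi)$ for $\xi\ge\xi_o$. The $L^1_{loc}$-continuity domain $\mathsf L$ is the set of $(u_\ell,u_r)\in\mathsf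 D$ such that $\int_{\xi_1}^{\xi_2}\|\mathcal{RS}[u_\ell',u_r'](\xi)-\mathcal{RS}[u_\ell,u_r](\xi)\|\,d\xi\to0$ as $(u_\ell',u_r')\to(u_\ell,u_r)$ in $\mathsf D$, for all $\xi_1,\xi_2\in\mathbb R$. A set $\mathcal I\subseteq\Omega$ is an invariant domain if $\mathcal I^2\subseteq\mathsf D$ and $\mathcal{RS}[u_\ell,u_r](\xi)\in\mathcal I$ for all $u_\ell,u_r\in\mathcal I$ and $\xi\in\mathbb R$. **Theorem.** For $\mathcal{RS}_{\rm v}$ the following hold. (I) $\mathsf{CH}=\mathsf A\cup\mathsf O_{\mathsf O}$, where $\mathsf O_{\mathsf O}=\{(u_\ell,u_r)\in\mathsf O:(u_{\rm p}^-,u_{\rm p}^+)\in\mathsf O\}$. (II) $\mathsf{CN}=\mathsf{CN}_1\cup\mathsf{CN}_2=\mathsf{CN}_{\mathsf O}\cup\mathsf{CN}_{\mathsf A}$, where $$\begin{aligned} \mathsf{CN}_1&=\{(u_\ell,u_r)\in\mathsf A_{\mathsf I}:(u_\ell,u_{\rm v}(\xi_o^-)),(u_{\rm v}(\xi_o^+),u_r)\in\mathsf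 A_{\mathsf I}^{\complement}\text{ for all }\xi_o^-<0\le\xi_o^+\},\\ \mathsf{CN}_2&=\{(u_\ell,u_r)\in\mathsf A_{\mathsf I}^{\complement}:(u_\ell,u_{\rm v}(\xi_o)),(u_{\rm v}(\xi_o),u_r)\in\mathsf A_{\mathsf I}^{\complement}\text{ for all }\xi_o\in\mathbb R\},\\ \mathsf{CN}_{\mathsf O}&=\{(u_\ell,u_r)\in\mathsf O:(u_\ell,u_\ell),(u_r,u_r),(u_\ell,\tilde u),(\tilde u,u_r)\in\mathsf A_{\mathsf I}^{\complement}\text{ and }q_{\rm p}\ne0\text{ along any rarefaction of }u_{\rm p}\text{, end states included}\},\\ \mathsf{CN}_{\mathsf A}&=\{(u_\ell,u_r)\in\mathsf A:q_\ell\ge0\ge q_r,\ (u_\ell,u_\ell),(u_r,u_r)\in\mathsf A_{\mathsf I}^{\complement}\}. \end{aligned}$$ (III) $\mathsf L=\{(u_\ell,u_r)\in\Omega^2:|\check p_r-\hat p_\ell|\ne M\}$. (IV) For every $u_0=(\rho_0,q_0)\in\Omega$ with $q_0=0$, the set $\mathcal I_{u_0}=\{u\in\Omega:z(u)\ge z(u_0),\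 w(u)\le w(u_0)\}$ is an invariant domain of $\mathcal{RS}_{\rm v}$. -/

import Mathlib

open Set Filter Topology MeasureTheory

namespace GasValve

noncomputable section

/-- A state `u = (ρ, q)`: density `u.1`, linear momentum `u.2`. -/
abbrev State := ℝ × ℝ

/-- The phase space `Ω = {(ρ, q) : ρ > 0}`. -/
def Omega : Set State := {u | 0 < u.1}

/-- The velocity `v = q / ρ`. -/
def vel (u : State) : ℝ := u.2 / u.1

/-- The isothermal pressure law `p(ρ) = a² ρ`. -/
def pressure (a ρ : ℝ) : ℝ := a ^ 2 * ρ

/-- First eigenvalue. -/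
def lam1 (a : ℝ) (u : State) : ℝ := vel u - a

/-- Second eigenvalue. -/
def lam2 (a : ℝ) (u : State) : ℝ := vel u + a

/-- Riemann invariant `w`. -/
def invW (a : ℝ) (u : State) : ℝ := u.2 / (a * u.1) + Real.log u.1

/-- Riemann invariant `z`. -/
def invZ (a : ℝ) (u : State) : ℝ := u.2 / (a * u.1) - Real.log u.1

/-! ### Lax curves -/

/-- Shock curve of the first family through `u`. -/
def S1 (a ρ : ℝ) (u : State) : ℝ :=
  ρ * (u.2 / u.1 - a * (√(ρ / u.1) - √(u.1 / ρ)))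

/-- Rarefaction curve of the first family through `u`. -/
def R1 (a ρ : ℝ) (u : State) : ℝ :=
  ρ * (u.2 / u.1 - a * Real.log (ρ / u.1))

/-- Shock curve of the second family through `u`. -/
def S2 (a ρ : ℝ) (u : State) : ℝ :=
  ρ * (u.2 / u.1 + a * (√(ρ / u.1) - √(u.1 / ρ)))

/-- Rarefaction curve of the second family through `u`. -/
def R2 (a ρ : ℝ) (u : State) : ℝ :=
  ρ * (u.2 / u.1 + a * Real.log (ρ / u.1))

/-- Forward Lax curve of the first family through `u`. -/
def FL1 (a ρ : ℝ) (u : State) : ℝ := if ρ ≤ u.1 then R1 a ρ u else S1 a ρ u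

/-- Backward Lax curve of the second family through `u`. -/
def BL2 (a ρ : ℝ) (u : State) : ℝ := if ρ ≤ u.1 then R2 a ρ u else S2 a ρ u

/-- Density of the intersection of `FL1` through `ul` and `BL2` through `ur`
(see `existsUnique_tilde`). -/
def tildeRho (a : ℝ) (ul ur : State) : ℝ :=
  Classical.epsilon fun ρ => 0 < ρ ∧ FL1 a ρ ul = BL2 a ρ ur

/-- The state `ũ(ul, ur)`, the unique element of `FL1^{ul} ∩ BL2^{ur}`. -/
def tilde (a : ℝ) (ul ur : State) : State :=
  (tildeRho a ul ur, FL1 a (tildeRho a ul ur) ul)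

/-- The largest density at which `FL1` through `u` meets the line `q = qm`. -/
def hatRho (a qm : ℝ) (u : State) : ℝ :=
  Classical.epsilon fun ρ => IsGreatest {r | 0 < r ∧ FL1 a r u = qm} ρ

/-- The state `û(qm, u)`. -/
def hat (a qm : ℝ) (u : State) : State := (hatRho a qm u, qm)

/-- The largest density at which `BL2` through `u` meets the line `q = qm`. -/
def checkRho (a qm : ℝ) (u : State) : ℝ :=
  Classical.epsilon fun ρ => IsGreatest {r | 0 < r ∧ BL2 a r u = qm} ρ

/-- The state `ǔ(qm, u)`. -/
def check (a qm : ℝ) (u : State) : State := (checkRho a qm u, qm)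

/-! ### Well-posedness of the choices above (for `qm = 0` in the case of `û` and `ǔ`) -/

/-- The function `t ↦ t` for `t ≤ 0`, `t ↦ 2 sinh (t / 2)` for `t > 0`. -/
def prof (t : ℝ) : ℝ := if t ≤ 0 then t else 2 * Real.sinh (t / 2)

theorem le_prof (t : ℝ) : t ≤ prof t := by
  unfold prof
  split_ifs with h
  · exact le_rfl
  · have : t / 2 ≤ Real.sinh (t / 2) := Real.self_le_sinh_iff.2 (by linarith)
    linarith

theorem prof_strictMono : StrictMono prof := by
  intro s t hst
  unfold prof
  have hm : Real.sinh (s / 2) < Real.sinh (t / 2) := Real.sinh_lt_sinh.2 (by linarith)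
  split_ifs with h1 h2 h2
  · exact hst
  · have : 0 < Real.sinh (t / 2) := Real.sinh_pos_iff.2 (by linarith)
    linarith
  · linarith
  · linarith

theorem prof_continuous : Continuous prof := by
  unfold prof
  refine Continuous.if_le continuous_id (by fun_prop) continuous_id continuous_const ?_
  intro x hx
  simp [hx]

theorem prof_atTop : Tendsto prof atTop atTop := tendsto_atTop_mono le_prof tendsto_id

theorem prof_atBot : Tendsto prof atBot atBot := by
  refine tendsto_id.congr' ?_
  filter_upwards [eventually_le_atBot (0 : ℝ)] with t ht
  simp [prof, ht]

theorem sqrt_diff (t m : ℝ) :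
    √(Real.exp t / Real.exp m) - √(Real.exp m / Real.exp t) = 2 * Real.sinh ((t - m) / 2) := by
  rw [← Real.exp_sub, ← Real.exp_sub, Real.sqrt_eq_rpow, ← Real.exp_mul,
    Real.sqrt_eq_rpow, ← Real.exp_mul, Real.sinh_eq]
  ring_nf

theorem FL1_exp (a t : ℝ) {u : State} (hu : u ∈ Omega) :
    FL1 a (Real.exp t) u = Real.exp t * (vel u - a * prof (t - Real.log u.1)) := by
  have hu' : 0 < u.1 := hu
  obtain ⟨m, hm⟩ : ∃ m, u.1 = Real.exp m := ⟨Real.log u.1, (Real.exp_log hu').symm⟩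
  simp only [FL1, R1, S1, vel, prof, hm, Real.exp_le_exp, Real.log_exp, sqrt_diff, sub_nonpos]
  split_ifs
  · rw [← Real.exp_sub, Real.log_exp]
  · rfl

theorem BL2_exp (a t : ℝ) {u : State} (hu : u ∈ Omega) :
    BL2 a (Real.exp t) u = Real.exp t * (vel u + a * prof (t - Real.log u.1)) := by
  have hu' : 0 < u.1 := hu
  obtain ⟨m, hm⟩ : ∃ m, u.1 = Real.exp m := ⟨Real.log u.1, (Real.exp_log hu').symm⟩
  simp only [BL2, R2, S2, vel, prof, hm, Real.exp_le_exp, Real.log_exp, sqrt_diff, sub_nonpos]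
  split_ifs
  · rw [← Real.exp_sub, Real.log_exp]
  · rfl

theorem shift_prof_surj (m c : ℝ) : ∃ t, prof (t - m) = c := by
  obtain ⟨s, hs⟩ := prof_continuous.surjective prof_atTop prof_atBot c
  exact ⟨s + m, by simpa using hs⟩

/-- The curves `FL1^{ul}` and `BL2^{ur}` meet in exactly one point. -/
theorem existsUnique_tilde {a : ℝ} (ha : 0 < a) {ul ur : State}
    (hl : ul ∈ Omega) (hr : ur ∈ Omega) :
    ∃! ρ, 0 < ρ ∧ FL1 a ρ ul = BL2 a ρ ur := by
  set F : ℝ → ℝ := fun t => prof (t - Real.log ul.1) + prof (t - Real.log ur.1) with hF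
  have key : ∀ t, FL1 a (Real.exp t) ul = BL2 a (Real.exp t) ur ↔
      F t = (vel ul - vel ur) / a := by
    intro t
    rw [FL1_exp a t hl, BL2_exp a t hr, mul_right_inj' (Real.exp_pos t).ne', eq_div_iff ha.ne']
    constructor <;> intro h <;> simp only [hF] at * <;> linarith
  have hmono : StrictMono F := fun s t h =>
    add_lt_add (prof_strictMono (by linarith)) (prof_strictMono (by linarith))
  have hcont : Continuous F :=
    (prof_continuous.comp (by fun_prop)).add (prof_continuous.comp (by fun_prop))
  have htop : Tendsto F atTop atTop :=
    (prof_atTop.comp (tendsto_atTop_add_const_right _ _ tendsto_id)).atTop_add_atTop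
      (prof_atTop.comp (tendsto_atTop_add_const_right _ _ tendsto_id))
  have hbot : Tendsto F atBot atBot :=
    (prof_atBot.comp (tendsto_atBot_add_const_right _ _ tendsto_id)).atBot_add_atBot
      (prof_atBot.comp (tendsto_atBot_add_const_right _ _ tendsto_id))
  obtain ⟨t, ht⟩ := hcont.surjective htop hbot ((vel ul - vel ur) / a)
  refine ⟨Real.exp t, ⟨Real.exp_pos t, (key t).2 ht⟩, ?_⟩
  rintro ρ ⟨hρ, h⟩
  rw [← Real.exp_log hρ] at h ⊢
  rw [hmono.injective (((key _).1 h).trans ht.symm)]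

theorem exists_hat {a : ℝ} (ha : 0 < a) {u : State} (hu : u ∈ Omega) :
    ∃ ρ, IsGreatest {r | 0 < r ∧ FL1 a r u = 0} ρ := by
  obtain ⟨t, ht⟩ := shift_prof_surj (Real.log u.1) (vel u / a)
  refine ⟨Real.exp t, ⟨Real.exp_pos t, ?_⟩, ?_⟩
  · rw [FL1_exp a t hu, ht]
    field_simp
    ring
  · rintro ρ ⟨hρ, h⟩
    rw [← Real.exp_log hρ] at h ⊢
    rw [FL1_exp a _ hu, mul_eq_zero, or_iff_right (Real.exp_pos _).ne'] at h
    have h2 : prof (Real.log ρ - Real.log u.1) = vel u / a := by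
      rw [eq_div_iff ha.ne']; linarith
    have := prof_strictMono.injective (h2.trans ht.symm)
    rw [sub_left_inj.1 this]

theorem exists_check {a : ℝ} (ha : 0 < a) {u : State} (hu : u ∈ Omega) :
    ∃ ρ, IsGreatest {r | 0 < r ∧ BL2 a r u = 0} ρ := by
  obtain ⟨t, ht⟩ := shift_prof_surj (Real.log u.1) (-vel u / a)
  refine ⟨Real.exp t, ⟨Real.exp_pos t, ?_⟩, ?_⟩
  · rw [BL2_exp a t hu, ht]
    field_simp
    ring
  · rintro ρ ⟨hρ, h⟩
    rw [← Real.exp_log hρ] at h ⊢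
    rw [BL2_exp a _ hu, mul_eq_zero, or_iff_right (Real.exp_pos _).ne'] at h
    have h2 : prof (Real.log ρ - Real.log u.1) = -vel u / a := by
      rw [eq_div_iff ha.ne']; linarith
    have := prof_strictMono.injective (h2.trans ht.symm)
    rw [sub_left_inj.1 this]

/-! ### The Lax Riemann solver -/

/-- Speed of a shock between two states (with different densities). -/
def shockSpeed (u u' : State) : ℝ := (u.2 - u'.2) / (u.1 - u'.1)

/-- Right-continuous profile of the wave of the first family from `u` to a state `u'` of
`FL1^u`: a shock if `ρ < ρ'`, a (possibly null) rarefaction otherwise. Inside the rarefaction the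
value at `ξ` is the state on `R1^u` whose first eigenvalue is `ξ`. -/
def wave1 (a : ℝ) (u u' : State) (ξ : ℝ) : State :=
  if u.1 < u'.1 then
    if ξ < shockSpeed u u' then u else u'
  else if ξ < lam1 a u then u
  else if ξ < lam1 a u' then
    (u.1 * Real.exp ((lam1 a u - ξ) / a),
      u.1 * Real.exp ((lam1 a u - ξ) / a) * (ξ + a))
  else u'

/-- Right-continuous profile of the wave of the second family from a state `u` of `BL2^{u'}` to
`u'`: a shock if `ρ' < ρ`, a (possibly null) rarefaction otherwise. Inside the rarefaction the
value at `ξ` is the state on `R2^u` whose second eigenvalue is `ξ`. -/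
def wave2 (a : ℝ) (u u' : State) (ξ : ℝ) : State :=
  if u'.1 < u.1 then
    if ξ < shockSpeed u u' then u else u'
  else if ξ < lam2 a u then u
  else if ξ < lam2 a u' then
    (u.1 * Real.exp ((ξ - lam2 a u) / a),
      u.1 * Real.exp ((ξ - lam2 a u) / a) * (ξ - a))
  else u'

/-- The Lax Riemann solver: a wave of the first family from `ul` to `ũ` followed by a wave of the
second family from `ũ` to `ur`. All speeds of the first wave are smaller, and all speeds of
the second wave are larger, than the velocity of `ũ`. -/
def RSp (a : ℝ) (ul ur : State) (ξ : ℝ) : State :=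
  if ξ < vel (tilde a ul ur) then wave1 a ul (tilde a ul ur) ξ
  else wave2 a (tilde a ul ur) ur ξ

/-! ### Properties of a coupling Riemann solver `RS` with domain `D` -/

/-- Coherence domain; the interface is at `ξ = 0`. -/
def coherenceDomain (D : Set (State × State)) (RS : State → State → ℝ → State) :
    Set (State × State) :=
  {d ∈ D |
    (Function.leftLim (RS d.1 d.2) 0, Function.rightLim (RS d.1 d.2) 0) ∈ D ∧
    ∀ ξ, RS (Function.leftLim (RS d.1 d.2) 0) (Function.rightLim (RS d.1 d.2) 0) ξ =
      if ξ < 0 then Function.leftLim (RS d.1 d.2) 0 else Function.rightLim (RS d.1 d.2) 0}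

/-- Consistency of `RS` at `(ul, ur)`. -/
def ConsistentAt (D : Set (State × State)) (RS : State → State → ℝ → State)
    (ul ur : State) : Prop :=
  ∀ ξo : ℝ,
    ((ul, RS ul ur ξo) ∈ D ∧ (RS ul ur ξo, ur) ∈ D) ∧
    ((∀ ξ, RS ul (RS ul ur ξo) ξ = if ξ < ξo then RS ul ur ξ else RS ul ur ξo) ∧
      (∀ ξ, RS (RS ul ur ξo) ur ξ = if ξ < ξo then RS ul ur ξo else RS ul ur ξ)) ∧
    (∀ ξ, RS ul ur ξ = if ξ < ξo then RS ul (RS ul ur ξo) ξ else RS (RS ul ur ξo) ur ξ)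

/-- Consistence domain. -/
def consistenceDomain (D : Set (State × State)) (RS : State → State → ℝ → State) :
    Set (State × State) :=
  {d ∈ D | ConsistentAt D RS d.1 d.2}

/-- `L¹_loc`-continuity domain. -/
def continuityDomain (D : Set (State × State)) (RS : State → State → ℝ → State) :
    Set (State × State) :=
  {d ∈ D | ∀ ξ₁ ξ₂ : ℝ,
    Tendsto (fun e : State × State =>
      ∫⁻ ξ in Icc ξ₁ ξ₂, ‖RS e.1 e.2 ξ - RS d.1 d.2 ξ‖ₑ) (𝓝[D] d) (𝓝 0)}

/-- `I ⊆ Ω` is an invariant domain of `RS`. -/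
def IsInvariantDomain (D : Set (State × State)) (RS : State → State → ℝ → State)
    (I : Set State) : Prop :=
  I ⊆ Omega ∧ I ×ˢ I ⊆ D ∧ ∀ ul ∈ I, ∀ ur ∈ I, ∀ ξ, RS ul ur ξ ∈ I

/-! ### The two-way electronic pressure valve -/

/-- The pressure jump `|p̌(0, ur) - p̂(0, ul)|` corresponding to a closed valve. -/
def closedJump (a : ℝ) (ul ur : State) : ℝ :=
  |pressure a (check a 0 ur).1 - pressure a (hat a 0 ul).1|

open Classical in
/-- The coupling Riemann solver of the valve: closed (flow `qm = 0` at `ξ = 0`) if the pressure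
jump is at most `M`, open otherwise. -/
def RSv (a M : ℝ) (ul ur : State) (ξ : ℝ) : State :=
  if closedJump a ul ur ≤ M then
    if ξ < 0 then RSp a ul (hat a 0 ul) ξ else RSp a (check a 0 ur) ur ξ
  else RSp a ul ur ξ

/-- The domain `Ω²` of the solver. -/
def domV : Set (State × State) := Omega ×ˢ Omega

/-- `A`: data for which the valve is active (closed). -/
def setA (a M : ℝ) : Set (State × State) := {d ∈ domV | closedJump a d.1 d.2 ≤ M}

/-- `O`: data for which the valve is open. -/
def setO (a M : ℝ) : Set (State × State) := {d ∈ domV | M < closedJump a d.1 d.2}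

/-- `A_N`: the valve is active but does not influence the flow. -/
def setAN (a M : ℝ) : Set (State × State) :=
  {d ∈ setA a M | ∀ ξ, RSv a M d.1 d.2 ξ = RSp a d.1 d.2 ξ}

/-- `A_I`: the valve is active and influences the flow. -/
def setAI (a M : ℝ) : Set (State × State) := setA a M \ setAN a M

/-- The complement of `A_I` in `Ω²`. -/
def setAIc (a M : ℝ) : Set (State × State) := domV \ setAI a M

/-- `O_O`: the valve is open, and open also for the traces at `0` of the Lax solution. -/
def setOO (a M : ℝ) : Set (State × State) :=
  {d ∈ setO a M |
    (Function.leftLim (RSp a d.1 d.2) 0, Function.rightLim (RSp a d.1 d.2) 0) ∈ setO a M}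

/-- `CN_1`. -/
def setCN1 (a M : ℝ) : Set (State × State) :=
  {d ∈ setAI a M | ∀ ξm ξp : ℝ, ξm < 0 → 0 ≤ ξp →
    (d.1, RSv a M d.1 d.2 ξm) ∈ setAIc a M ∧ (RSv a M d.1 d.2 ξp, d.2) ∈ setAIc a M}

/-- `CN_2`. -/
def setCN2 (a M : ℝ) : Set (State × State) :=
  {d ∈ setAIc a M | ∀ ξ : ℝ,
    (d.1, RSv a M d.1 d.2 ξ) ∈ setAIc a M ∧ (RSv a M d.1 d.2 ξ, d.2) ∈ setAIc a M}

/-- The momentum of the Lax solution does not vanish along any of its rarefactions, the end states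
of a rarefaction included. -/
def NonzeroAlongRarefactions (a : ℝ) (ul ur : State) : Prop :=
  ((tilde a ul ur).1 < ul.1 →
    ∀ ξ ∈ Icc (lam1 a ul) (lam1 a (tilde a ul ur)), (RSp a ul ur ξ).2 ≠ 0) ∧
  ((tilde a ul ur).1 < ur.1 →
    ∀ ξ ∈ Icc (lam2 a (tilde a ul ur)) (lam2 a ur), (RSp a ul ur ξ).2 ≠ 0)

/-- `CN_O`. -/
def setCNO (a M : ℝ) : Set (State × State) :=
  {d ∈ setO a M |
    ((d.1, d.1) ∈ setAIc a M ∧ (d.2, d.2) ∈ setAIc a M ∧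
      (d.1, tilde a d.1 d.2) ∈ setAIc a M ∧ (tilde a d.1 d.2, d.2) ∈ setAIc a M) ∧
    NonzeroAlongRarefactions a d.1 d.2}

/-- `CN_A`. -/
def setCNA (a M : ℝ) : Set (State × State) :=
  {d ∈ setA a M | (0 ≤ d.1.2 ∧ d.2.2 ≤ 0) ∧
    (d.1, d.1) ∈ setAIc a M ∧ (d.2, d.2) ∈ setAIc a M}

/-- The set `I_{u₀} = {u ∈ Ω : z(u) ≥ z(u₀), w(u) ≤ w(u₀)}`. -/
def invRegion (a : ℝ) (u₀ : State) : Set State :=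
  {u ∈ Omega | invZ a u₀ ≤ invZ a u ∧ invW a u ≤ invW a u₀}

end

end GasValve

namespace GasValve

noncomputable section

/-! ### The inverse of `prof` -/

/-! In the coordinates (log ρ, v/a) both Lax curves are, up to sign, translates of the graph of
`prof`. The constant a then only rescales ξ, and the threshold becomes K = M/a² for the density jump
`logJump`. What matters about `prof` is that it is a continuous increasing bijection of ℝ, equals t
for t ≤ 0, is at least t everywhere, and expands distances.

Two facts about the Lax solver carry the argument. It is consistent: cutting a solution at any of
its values gives two Lax solutions (`logLax_consistent`). Its traces at 0 form a coherent pair, and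
they are both at rest only if the middle state is at rest (`logLax_traces`). A closed valve has the
two wall states as traces, both at rest. Hence it can agree with the Lax solution only if the middle
state is at rest; that state is then both walls and the jump is 0. So lying outside A_I means
`Unaffected`: the middle state is at rest or the jump exceeds K.

(I) A closed solution is coherent because taking the wall of a wall changes nothing. An open one
fails to be coherent exactly when its traces close the valve: a coherent closed pair would be at
rest, which forces jump 0 in the original data.

(II) By consistency of the Lax solver, the valve is consistent exactly when every subproblem that
has to reproduce a piece of Lax wave is `Unaffected`. A rarefaction that meets a state at rest is an
obstruction, since for states near rest the jump tends to 0 while the velocity is nonzero. In the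
open case, along a rarefaction without rest states the wall densities are monotone, so the jumps
exceed K as soon as the end conditions hold (`lt_logJump_rarefaction1`, `lt_logJump_rarefaction2`).

(III) Away from jump = K the branch is locally constant, and the profiles converge off a countable
set and boundedly, so dominated convergence applies. At jump = K, data with a larger jump give Lax
profiles; continuity would make the closed and the Lax profile equal almost everywhere, hence their
traces equal, hence the jump 0, against K > 0.

(IV) The region is a wedge log ρ ± v/a ≤ r; since `prof` lies above the identity, neither the middle
state nor the walls leave it. -/

theorem prof_zero : prof 0 = 0 := by simp [prof]

theorem prof_of_nonpos {t : ℝ} (h : t ≤ 0) : prof t = t := if_pos h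

theorem prof_of_pos {t : ℝ} (h : 0 < t) : prof t = Real.exp (t / 2) - Real.exp (-(t / 2)) := by
  rw [prof, if_neg h.not_ge, Real.sinh_eq]; ring

theorem prof_surjective : Function.Surjective prof :=
  prof_continuous.surjective prof_atTop prof_atBot

theorem prof_pos_iff {t : ℝ} : 0 < prof t ↔ 0 < t := by
  conv_lhs => rw [← prof_zero, prof_strictMono.lt_iff_lt]

/-- `prof` expands distances. -/
theorem sub_le_prof_sub {s t : ℝ} (h : s ≤ t) : t - s ≤ prof t - prof s := by
  have key := Real.sinh_sub_id_strictMono.monotone (show s / 2 ≤ t / 2 by linarith)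
  unfold prof
  split_ifs with h1 h2 h2
  · exact le_rfl
  · linarith
  · have : t / 2 ≤ Real.sinh (t / 2) := Real.self_le_sinh_iff.2 (by linarith)
    linarith
  · linarith

/-- The order isomorphism given by `prof`. -/
def profIso : ℝ ≃o ℝ := prof_strictMono.orderIsoOfSurjective prof prof_surjective

/-- The inverse of `prof`. -/
def profInv (y : ℝ) : ℝ := profIso.symm y

theorem prof_profInv (y : ℝ) : prof (profInv y) = y := profIso.apply_symm_apply y

theorem profInv_prof (t : ℝ) : profInv (prof t) = t := profIso.symm_apply_apply t

theorem profInv_continuous : Continuous profInv := profIso.symm.continuous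

theorem profInv_strictMono : StrictMono profInv := profIso.symm.strictMono

theorem profInv_le (y : ℝ) : profInv y ≤ y := by
  simpa [prof_profInv] using le_prof (profInv y)

theorem profInv_of_nonpos {y : ℝ} (h : y ≤ 0) : profInv y = y := by
  conv_lhs => rw [← prof_of_nonpos h, profInv_prof]

theorem profInv_zero : profInv 0 = 0 := profInv_of_nonpos le_rfl

/-- The inverse of an expanding map is 1-Lipschitz. This gives the monotonicity of the wall density
along a rarefaction whose velocity points towards the wall. -/
theorem profInv_sub_le {s t : ℝ} (h : s ≤ t) : profInv t - profInv s ≤ t - s := by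
  simpa [prof_profInv] using sub_le_prof_sub (profInv_strictMono.monotone h)

/-! ### Logarithmic coordinates -/

/-- The state with log-density `p.1` and velocity `a * p.2`. -/
def toState (a : ℝ) (p : ℝ × ℝ) : State := (Real.exp p.1, Real.exp p.1 * (a * p.2))

/-- The log-density and the rescaled velocity of a state. -/
def toLog (a : ℝ) (u : State) : ℝ × ℝ := (Real.log u.1, u.2 / (a * u.1))

theorem toState_mem (a : ℝ) (p : ℝ × ℝ) : toState a p ∈ Omega := Real.exp_pos p.1

theorem toState_toLog {a : ℝ} (ha : 0 < a) {u : State} (hu : u ∈ Omega) :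
    toState a (toLog a u) = u := by
  have hu' : 0 < u.1 := hu
  ext
  · exact Real.exp_log hu'
  · simp only [toState, toLog, Real.exp_log hu']
    field_simp

theorem toLog_toState {a : ℝ} (ha : 0 < a) (p : ℝ × ℝ) : toLog a (toState a p) = p := by
  ext
  · exact Real.log_exp _
  · simp only [toState, toLog]
    field_simp

theorem toState_injective {a : ℝ} (ha : 0 < a) : Function.Injective (toState a) :=
  Function.LeftInverse.injective (toLog_toState ha)

theorem exists_toState {a : ℝ} (ha : 0 < a) {u : State} (hu : u ∈ Omega) :
    ∃ p, u = toState a p := ⟨toLog a u, (toState_toLog ha hu).symm⟩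

theorem toState_continuous (a : ℝ) : Continuous (toState a) := by
  unfold toState; fun_prop

theorem toLog_continuousAt {a : ℝ} (ha : 0 < a) {u : State} (hu : u ∈ Omega) :
    ContinuousAt (toLog a) u := by
  have hu' : 0 < u.1 := hu
  unfold toLog
  exact (continuousAt_fst.log hu'.ne').prodMk
    (continuousAt_snd.div (continuousAt_const.mul continuousAt_fst) (mul_pos ha hu').ne')

theorem vel_toState (a : ℝ) (p : ℝ × ℝ) : vel (toState a p) = a * p.2 :=
  mul_div_cancel_left₀ _ (Real.exp_pos _).ne'

theorem toState_snd_eq_zero {a : ℝ} (ha : 0 < a) {p : ℝ × ℝ} :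
    (toState a p).2 = 0 ↔ p.2 = 0 := by
  simp [toState, ha.ne']

theorem FL1_toState (a t : ℝ) (p : ℝ × ℝ) :
    FL1 a (Real.exp t) (toState a p) = Real.exp t * (a * (p.2 - prof (t - p.1))) := by
  rw [FL1_exp a t (toState_mem a p), vel_toState, show (toState a p).1 = Real.exp p.1 from rfl,
    Real.log_exp]
  ring

theorem BL2_toState (a t : ℝ) (p : ℝ × ℝ) :
    BL2 a (Real.exp t) (toState a p) = Real.exp t * (a * (p.2 + prof (t - p.1))) := by
  rw [BL2_exp a t (toState_mem a p), vel_toState, show (toState a p).1 = Real.exp p.1 from rfl,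
    Real.log_exp]
  ring

/-- `s` lies on the forward Lax curve of the first family through `p`. -/
def OnLax1 (p s : ℝ × ℝ) : Prop := s.2 = p.2 - prof (s.1 - p.1)

/-- `s` lies on the backward Lax curve of the second family through `q`. -/
def OnLax2 (s q : ℝ × ℝ) : Prop := s.2 = q.2 + prof (s.1 - q.1)

theorem OnLax1.refl (p : ℝ × ℝ) : OnLax1 p p := by simp [OnLax1, prof_zero]

theorem OnLax2.refl (p : ℝ × ℝ) : OnLax2 p p := by simp [OnLax2, prof_zero]

/-- The curves no longer depend on a in these coordinates, so the case a = 1 of `existsUnique_tilde`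
suffices. -/
theorem exists_middle (p q : ℝ × ℝ) : ∃ s, OnLax1 p s ∧ OnLax2 s q := by
  obtain ⟨ρ, ⟨hρ, h⟩, -⟩ := existsUnique_tilde one_pos (toState_mem 1 p) (toState_mem 1 q)
  rw [← Real.exp_log hρ, FL1_toState, BL2_toState, mul_right_inj' (Real.exp_pos _).ne',
    one_mul, one_mul] at h
  exact ⟨(Real.log ρ, p.2 - prof (Real.log ρ - p.1)), rfl, h⟩

/-- The middle state of the Riemann problem with data `p`, `q`. -/
def middle (p q : ℝ × ℝ) : ℝ × ℝ := (exists_middle p q).choose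

theorem onLax1_middle (p q : ℝ × ℝ) : OnLax1 p (middle p q) := (exists_middle p q).choose_spec.1

theorem onLax2_middle (p q : ℝ × ℝ) : OnLax2 (middle p q) q := (exists_middle p q).choose_spec.2

theorem eq_of_onLax {p q s s' : ℝ × ℝ} (h1 : OnLax1 p s) (h2 : OnLax2 s q)
    (h1' : OnLax1 p s') (h2' : OnLax2 s' q) : s = s' := by
  unfold OnLax1 OnLax2 at *
  have hm : StrictMono fun t => prof (t - p.1) + prof (t - q.1) := fun s t h =>
    add_lt_add (prof_strictMono (by linarith)) (prof_strictMono (by linarith))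
  have h : s.1 = s'.1 := hm.injective (by linarith)
  exact Prod.ext h (by rw [h1, h1', h])

theorem middle_eq {p q s : ℝ × ℝ} (h1 : OnLax1 p s) (h2 : OnLax2 s q) : middle p q = s :=
  eq_of_onLax (onLax1_middle p q) (onLax2_middle p q) h1 h2

theorem middle_eq_right {p s : ℝ × ℝ} (h : OnLax1 p s) : middle p s = s :=
  middle_eq h (OnLax2.refl s)

theorem middle_eq_left {s q : ℝ × ℝ} (h : OnLax2 s q) : middle s q = s :=
  middle_eq (OnLax1.refl s) h

theorem tilde_toState {a : ℝ} (ha : 0 < a) (p q : ℝ × ℝ) :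
    tilde a (toState a p) (toState a q) = toState a (middle p q) := by
  have hex := existsUnique_tilde ha (toState_mem a p) (toState_mem a q)
  have hs : 0 < Real.exp (middle p q).1 ∧ FL1 a (Real.exp (middle p q).1) (toState a p) =
      BL2 a (Real.exp (middle p q).1) (toState a q) := by
    refine ⟨Real.exp_pos _, ?_⟩
    rw [FL1_toState, BL2_toState, ← onLax1_middle p q, ← onLax2_middle p q]
  have h : tildeRho a (toState a p) (toState a q) = Real.exp (middle p q).1 :=
    hex.unique (Classical.epsilon_spec hex.exists) hs
  rw [tilde, h, FL1_toState, ← onLax1_middle p q]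
  rfl

/-- The state at rest on the forward Lax curve of the first family through `p`. -/
def wallHat (p : ℝ × ℝ) : ℝ × ℝ := (p.1 + profInv p.2, 0)

/-- The state at rest on the backward Lax curve of the second family through `q`. -/
def wallCheck (q : ℝ × ℝ) : ℝ × ℝ := (q.1 + profInv (-q.2), 0)

theorem onLax1_wallHat (p : ℝ × ℝ) : OnLax1 p (wallHat p) := by
  simp [OnLax1, wallHat, prof_profInv]

theorem onLax2_wallCheck (q : ℝ × ℝ) : OnLax2 (wallCheck q) q := by
  simp [OnLax2, wallCheck, prof_profInv]

/-- `prof` is injective, so a Lax curve has only one state at rest. -/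
theorem eq_wallHat {p s : ℝ × ℝ} (h : OnLax1 p s) (hs : s.2 = 0) : s = wallHat p := by
  have h' : prof (s.1 - p.1) = p.2 := by unfold OnLax1 at h; linarith
  ext
  · simp [wallHat, ← h', profInv_prof]
  · exact hs

theorem eq_wallCheck {s q : ℝ × ℝ} (h : OnLax2 s q) (hs : s.2 = 0) : s = wallCheck q := by
  have h' : prof (s.1 - q.1) = -q.2 := by unfold OnLax2 at h; linarith
  ext
  · simp [wallCheck, ← h', profInv_prof]
  · exact hs

theorem hat_toState {a : ℝ} (ha : 0 < a) (p : ℝ × ℝ) :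
    hat a 0 (toState a p) = toState a (wallHat p) := by
  obtain ⟨⟨h0, h1⟩, -⟩ := Classical.epsilon_spec (exists_hat ha (toState_mem a p))
  change 0 < hatRho a 0 (toState a p) at h0
  change FL1 a (hatRho a 0 (toState a p)) (toState a p) = 0 at h1
  rw [← Real.exp_log h0, FL1_toState] at h1
  have h2 : p.2 - prof (Real.log (hatRho a 0 (toState a p)) - p.1) = 0 := by
    simpa [ha.ne'] using h1
  have := eq_wallHat (p := p) (s := (Real.log (hatRho a 0 (toState a p)), 0)) h2.symm rfl
  rw [← this, hat]
  ext
  · exact (Real.exp_log h0).symm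
  · simp [toState]

theorem check_toState {a : ℝ} (ha : 0 < a) (p : ℝ × ℝ) :
    check a 0 (toState a p) = toState a (wallCheck p) := by
  obtain ⟨⟨h0, h1⟩, -⟩ := Classical.epsilon_spec (exists_check ha (toState_mem a p))
  change 0 < checkRho a 0 (toState a p) at h0
  change BL2 a (checkRho a 0 (toState a p)) (toState a p) = 0 at h1
  rw [← Real.exp_log h0, BL2_toState] at h1
  have h2 : p.2 + prof (Real.log (checkRho a 0 (toState a p)) - p.1) = 0 := by
    simpa [ha.ne'] using h1
  have := eq_wallCheck (q := p) (s := (Real.log (checkRho a 0 (toState a p)), 0)) h2.symm rfl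
  rw [← this, check]
  ext
  · exact (Real.exp_log h0).symm
  · simp [toState]

/-! ### Waves in logarithmic coordinates -/

/-- The wave of the first family from `p` to `s`. -/
def logWave1 (p s : ℝ × ℝ) (x : ℝ) : ℝ × ℝ :=
  if p.1 < s.1 then if x < p.2 - Real.exp ((s.1 - p.1) / 2) then p else s
  else if x < p.2 - 1 then p
  else if x < s.2 - 1 then (p.1 + p.2 - (x + 1), x + 1)
  else s

/-- The wave of the second family from `s` to `q`. -/
def logWave2 (s q : ℝ × ℝ) (x : ℝ) : ℝ × ℝ :=
  if q.1 < s.1 then if x < q.2 + Real.exp ((s.1 - q.1) / 2) then s else q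
  else if x < s.2 + 1 then s
  else if x < q.2 + 1 then (s.1 - s.2 + (x - 1), x - 1)
  else q

/-- The Lax solver. -/
def logLax (p q : ℝ × ℝ) (x : ℝ) : ℝ × ℝ :=
  if x < (middle p q).2 then logWave1 p (middle p q) x else logWave2 (middle p q) q x

/-- With E = exp((s.1 - p.1)/2) the density ratio is E² and the velocity drop is a(E - 1/E), so the
Rankine–Hugoniot quotient is a rational function of E. -/
theorem shockSpeed1_toState {a : ℝ} {p s : ℝ × ℝ} (h : OnLax1 p s)
    (hps : p.1 < s.1) :
    shockSpeed (toState a p) (toState a s) = a * (p.2 - Real.exp ((s.1 - p.1) / 2)) := by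
  have hs : Real.exp s.1 = Real.exp p.1 * Real.exp ((s.1 - p.1) / 2) ^ 2 := by
    rw [← Real.exp_nat_mul, ← Real.exp_add]; congr 1; push_cast; ring
  have h2 : s.2 = p.2 - (Real.exp ((s.1 - p.1) / 2) - (Real.exp ((s.1 - p.1) / 2))⁻¹) := by
    rw [← Real.exp_neg, ← prof_of_pos (sub_pos.2 hps)]; exact h
  have hE : 1 < Real.exp ((s.1 - p.1) / 2) := Real.one_lt_exp_iff.2 (by linarith)
  simp only [shockSpeed, toState, hs, h2]
  generalize Real.exp ((s.1 - p.1) / 2) = E at hE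
  have hp := Real.exp_pos p.1
  generalize Real.exp p.1 = R at hp
  have h3 : R - R * E ^ 2 ≠ 0 := by
    have : R - R * E ^ 2 = -(R * ((E - 1) * (E + 1))) := by ring
    rw [this]
    exact neg_ne_zero.2 (mul_pos hp (mul_pos (by linarith) (by linarith))).ne'
  have hE0 : E ≠ 0 := by linarith
  rw [div_eq_iff h3]
  field_simp
  ring

theorem shockSpeed2_toState {a : ℝ} {s q : ℝ × ℝ} (h : OnLax2 s q)
    (hsq : q.1 < s.1) :
    shockSpeed (toState a s) (toState a q) = a * (q.2 + Real.exp ((s.1 - q.1) / 2)) := by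
  have hs : Real.exp s.1 = Real.exp q.1 * Real.exp ((s.1 - q.1) / 2) ^ 2 := by
    rw [← Real.exp_nat_mul, ← Real.exp_add]; congr 1; push_cast; ring
  have h2 : s.2 = q.2 + (Real.exp ((s.1 - q.1) / 2) - (Real.exp ((s.1 - q.1) / 2))⁻¹) := by
    rw [← Real.exp_neg, ← prof_of_pos (sub_pos.2 hsq)]; exact h
  have hE : 1 < Real.exp ((s.1 - q.1) / 2) := Real.one_lt_exp_iff.2 (by linarith)
  simp only [shockSpeed, toState, hs, h2]
  generalize Real.exp ((s.1 - q.1) / 2) = E at hE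
  have hp := Real.exp_pos q.1
  generalize Real.exp q.1 = R at hp
  have h3 : R * E ^ 2 - R ≠ 0 := by
    have : R * E ^ 2 - R = R * ((E - 1) * (E + 1)) := by ring
    rw [this]
    exact (mul_pos hp (mul_pos (by linarith) (by linarith))).ne'
  have hE0 : E ≠ 0 := by linarith
  rw [div_eq_iff h3]
  field_simp
  ring

theorem wave1_toState {a : ℝ} (ha : 0 < a) {p s : ℝ × ℝ} (h : OnLax1 p s) (x : ℝ) :
    wave1 a (toState a p) (toState a s) (a * x) = toState a (logWave1 p s x) := by
  have hl : ∀ r : ℝ × ℝ, lam1 a (toState a r) = a * (r.2 - 1) := fun r => by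
    rw [lam1, vel_toState]; ring
  unfold wave1 logWave1
  simp only [show ∀ r, (toState a r).1 = Real.exp r.1 from fun _ => rfl, Real.exp_lt_exp, hl,
    mul_lt_mul_iff_right₀ ha]
  by_cases hps : p.1 < s.1
  · simp only [if_pos hps, shockSpeed1_toState h hps, mul_lt_mul_iff_right₀ ha,
      apply_ite (toState a)]
  · simp only [if_neg hps, apply_ite (toState a)]
    have : Real.exp p.1 * Real.exp ((a * (p.2 - 1) - a * x) / a) =
        Real.exp (p.1 + p.2 - (x + 1)) := by
      rw [← Real.exp_add]; congr 1; field_simp; ring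
    rw [this]
    simp only [toState, show a * (x + 1) = a * x + a by ring]

theorem wave2_toState {a : ℝ} (ha : 0 < a) {s q : ℝ × ℝ} (h : OnLax2 s q) (x : ℝ) :
    wave2 a (toState a s) (toState a q) (a * x) = toState a (logWave2 s q x) := by
  have hl : ∀ r : ℝ × ℝ, lam2 a (toState a r) = a * (r.2 + 1) := fun r => by
    rw [lam2, vel_toState]; ring
  unfold wave2 logWave2
  simp only [show ∀ r, (toState a r).1 = Real.exp r.1 from fun _ => rfl, Real.exp_lt_exp, hl,
    mul_lt_mul_iff_right₀ ha]
  by_cases hps : q.1 < s.1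
  · simp only [if_pos hps, shockSpeed2_toState h hps, mul_lt_mul_iff_right₀ ha,
      apply_ite (toState a)]
  · simp only [if_neg hps, apply_ite (toState a)]
    have : Real.exp s.1 * Real.exp ((a * x - a * (s.2 + 1)) / a) =
        Real.exp (s.1 - s.2 + (x - 1)) := by
      rw [← Real.exp_add]; congr 1; field_simp; ring
    rw [this]
    simp only [toState, show a * (x - 1) = a * x - a by ring]

theorem RSp_toState_mul {a : ℝ} (ha : 0 < a) (p q : ℝ × ℝ) (x : ℝ) :
    RSp a (toState a p) (toState a q) (a * x) = toState a (logLax p q x) := by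
  simp only [RSp, tilde_toState ha, vel_toState, mul_lt_mul_iff_right₀ ha,
    wave1_toState ha (onLax1_middle p q), wave2_toState ha (onLax2_middle p q), logLax,
    apply_ite (toState a)]

theorem RSp_toState {a : ℝ} (ha : 0 < a) (p q : ℝ × ℝ) (ξ : ℝ) :
    RSp a (toState a p) (toState a q) ξ = toState a (logLax p q (ξ / a)) := by
  rw [← RSp_toState_mul ha, mul_div_cancel₀ _ (ne_of_gt ha)]

/-- The density jump across the closed valve. -/
def logJump (p q : ℝ × ℝ) : ℝ := |Real.exp (wallCheck q).1 - Real.exp (wallHat p).1|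

theorem closedJump_toState {a : ℝ} (ha : 0 < a) (p q : ℝ × ℝ) :
    closedJump a (toState a p) (toState a q) = a ^ 2 * logJump p q := by
  rw [closedJump, hat_toState ha, check_toState ha, pressure, pressure, ← mul_sub, abs_mul,
    abs_of_pos (by positivity : 0 < a ^ 2)]
  rfl

open Classical in
/-- The valve solver with density threshold `K`. -/
def logValve (K : ℝ) (p q : ℝ × ℝ) (x : ℝ) : ℝ × ℝ :=
  if logJump p q ≤ K then if x < 0 then logWave1 p (wallHat p) x else logWave2 (wallCheck q) q x
  else logLax p q x

/-! ### Structure of the waves -/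

theorem OnLax1.eq_of_le {p s : ℝ × ℝ} (h : OnLax1 p s) (hle : ¬ p.1 < s.1) :
    s.2 = p.2 + p.1 - s.1 := by
  rw [OnLax1, prof_of_nonpos (by linarith)] at h; linarith

theorem OnLax2.eq_of_le {s q : ℝ × ℝ} (h : OnLax2 s q) (hle : ¬ q.1 < s.1) :
    s.2 = q.2 + s.1 - q.1 := by
  rw [OnLax2, prof_of_nonpos (by linarith)] at h; linarith

/-- The shock speed seen from the state behind it: it is below s.2, which is why 1-waves ending at
rest have negative speed. -/
theorem OnLax1.speed_eq {p s : ℝ × ℝ} (h : OnLax1 p s) (hlt : p.1 < s.1) :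
    p.2 - Real.exp ((s.1 - p.1) / 2) = s.2 - Real.exp (-((s.1 - p.1) / 2)) := by
  rw [OnLax1, prof_of_pos (by linarith)] at h; linarith

theorem OnLax2.speed_eq {s q : ℝ × ℝ} (h : OnLax2 s q) (hlt : q.1 < s.1) :
    q.2 + Real.exp ((s.1 - q.1) / 2) = s.2 + Real.exp (-((s.1 - q.1) / 2)) := by
  rw [OnLax2, prof_of_pos (by linarith)] at h; linarith

theorem OnLax1.snd_lt {p s : ℝ × ℝ} (h : OnLax1 p s) (hlt : p.1 < s.1) : s.2 < p.2 := by
  have := prof_pos_iff.2 (sub_pos.2 hlt)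
  unfold OnLax1 at h; linarith

theorem OnLax2.snd_lt {s q : ℝ × ℝ} (h : OnLax2 s q) (hlt : q.1 < s.1) : q.2 < s.2 := by
  have := prof_pos_iff.2 (sub_pos.2 hlt)
  unfold OnLax2 at h; linarith

theorem OnLax1.eq_of_fst_eq {p s : ℝ × ℝ} (h : OnLax1 p s) (he : p.1 = s.1) : p = s := by
  have := h.eq_of_le he.not_lt
  exact Prod.ext he (by linarith)

theorem OnLax2.eq_of_fst_eq {s q : ℝ × ℝ} (h : OnLax2 s q) (he : q.1 = s.1) : s = q := by
  have := h.eq_of_le he.not_lt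
  exact Prod.ext he.symm (by linarith)

theorem logWave1_self (p : ℝ × ℝ) (x : ℝ) : logWave1 p p x = p := by
  unfold logWave1; split_ifs <;> grind

theorem logWave2_self (p : ℝ × ℝ) (x : ℝ) : logWave2 p p x = p := by
  unfold logWave2; split_ifs <;> grind

/-- A wave of the first family is slower than the flow behind it. -/
theorem logWave1_eventually_eq {p s : ℝ × ℝ} (h : OnLax1 p s) :
    ∃ y < s.2, ∀ x, y ≤ x → logWave1 p s x = s := by
  by_cases hlt : p.1 < s.1
  · refine ⟨p.2 - Real.exp ((s.1 - p.1) / 2), ?_, fun x hx => ?_⟩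
    · rw [h.speed_eq hlt]; linarith [Real.exp_pos (-((s.1 - p.1) / 2))]
    · rw [logWave1, if_pos hlt, if_neg hx.not_gt]
  · refine ⟨s.2 - 1, by linarith, fun x hx => ?_⟩
    have := h.eq_of_le hlt
    rw [logWave1, if_neg hlt, if_neg (by linarith), if_neg (by linarith)]

/-- A wave of the second family is faster than the flow in front of it. -/
theorem logWave2_eventually_eq {s q : ℝ × ℝ} (h : OnLax2 s q) :
    ∃ y > s.2, ∀ x, x < y → logWave2 s q x = s := by
  by_cases hlt : q.1 < s.1
  · refine ⟨q.2 + Real.exp ((s.1 - q.1) / 2), ?_, fun x hx => ?_⟩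
    · rw [h.speed_eq hlt]; linarith [Real.exp_pos (-((s.1 - q.1) / 2))]
    · rw [logWave2, if_pos hlt, if_pos hx]
  · refine ⟨s.2 + 1, by linarith, fun x hx => ?_⟩
    rw [logWave2, if_neg hlt, if_pos hx]

theorem logWave1_of_le {p s : ℝ × ℝ} (h : OnLax1 p s) {x : ℝ} (hx : s.2 ≤ x) :
    logWave1 p s x = s := by
  obtain ⟨y, hy, H⟩ := logWave1_eventually_eq h
  exact H x (hy.le.trans hx)

theorem logWave2_of_le {s q : ℝ × ℝ} (h : OnLax2 s q) {x : ℝ} (hx : x ≤ s.2) :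
    logWave2 s q x = s := by
  obtain ⟨y, hy, H⟩ := logWave2_eventually_eq h
  exact H x (hx.trans_lt hy)

/-- The end state is attained before any given ray. This extracts the condition on (p, p) from
conditions on all values of the profile. -/
theorem exists_logWave1_eq_left (p s : ℝ × ℝ) (y : ℝ) : ∃ x < y, logWave1 p s x = p := by
  by_cases hlt : p.1 < s.1
  · refine ⟨min y (p.2 - Real.exp ((s.1 - p.1) / 2)) - 1, ?_, ?_⟩
    · linarith [min_le_left y (p.2 - Real.exp ((s.1 - p.1) / 2))]
    · rw [logWave1, if_pos hlt, if_pos]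
      linarith [min_le_right y (p.2 - Real.exp ((s.1 - p.1) / 2))]
  · refine ⟨min y (p.2 - 1) - 1, ?_, ?_⟩
    · linarith [min_le_left y (p.2 - 1)]
    · rw [logWave1, if_neg hlt, if_pos]
      linarith [min_le_right y (p.2 - 1)]

theorem exists_logWave2_eq_right {s q : ℝ × ℝ} (h : OnLax2 s q) (y : ℝ) :
    ∃ x, y ≤ x ∧ logWave2 s q x = q := by
  by_cases hlt : q.1 < s.1
  · refine ⟨max y (q.2 + Real.exp ((s.1 - q.1) / 2)), le_max_left _ _, ?_⟩
    rw [logWave2, if_pos hlt, if_neg (le_max_right _ _).not_gt]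
  · refine ⟨max y (q.2 + 1), le_max_left _ _, ?_⟩
    have := h.eq_of_le hlt
    have := le_max_right y (q.2 + 1)
    rw [logWave2, if_neg hlt, if_neg (by linarith), if_neg (by linarith)]

theorem logWave1_cases {p s : ℝ × ℝ} (h : OnLax1 p s) (x : ℝ) :
    logWave1 p s x = p ∨ logWave1 p s x = s ∨
      s.1 < p.1 ∧ x + 1 ∈ Icc p.2 s.2 ∧ logWave1 p s x = (p.1 + p.2 - (x + 1), x + 1) := by
  unfold logWave1
  split_ifs with h1 h2 h2 h3
  · simp
  · simp
  · simp
  · have := h.eq_of_le h1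
    exact Or.inr (Or.inr ⟨by linarith, ⟨by linarith, by linarith⟩, rfl⟩)
  · simp

theorem logWave2_cases {s q : ℝ × ℝ} (h : OnLax2 s q) (x : ℝ) :
    logWave2 s q x = s ∨ logWave2 s q x = q ∨
      s.1 < q.1 ∧ x - 1 ∈ Icc s.2 q.2 ∧ logWave2 s q x = (s.1 - s.2 + (x - 1), x - 1) := by
  unfold logWave2
  split_ifs with h1 h2 h2 h3
  · simp
  · simp
  · simp
  · have := h.eq_of_le h1
    exact Or.inr (Or.inr ⟨by linarith, ⟨by linarith, by linarith⟩, rfl⟩)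
  · simp

/-- On a 1-rarefaction the sum of the two coordinates is constant (the invariant w), so the velocity
c serves as parameter. -/
theorem onLax1_rarefaction {p : ℝ × ℝ} {c d : ℝ} (hcd : c ≤ d) :
    OnLax1 (p.1 + p.2 - c, c) (p.1 + p.2 - d, d) := by
  rw [OnLax1, prof_of_nonpos (by simpa using hcd)]; simp

theorem onLax2_rarefaction {s : ℝ × ℝ} {c d : ℝ} (hcd : c ≤ d) :
    OnLax2 (s.1 - s.2 + c, c) (s.1 - s.2 + d, d) := by
  rw [OnLax2, prof_of_nonpos (by simpa using hcd)]; simp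

theorem OnLax1.eq_rarefaction {p s : ℝ × ℝ} (h : OnLax1 p s) (hlt : ¬ p.1 < s.1) :
    s = (p.1 + p.2 - s.2, s.2) := by
  have := h.eq_of_le hlt
  exact Prod.ext (by simp only; linarith) rfl

theorem OnLax2.eq_rarefaction {s q : ℝ × ℝ} (h : OnLax2 s q) (hlt : ¬ q.1 < s.1) :
    q = (s.1 - s.2 + q.2, q.2) := by
  have := h.eq_of_le hlt
  exact Prod.ext (by simp only; linarith) rfl

theorem OnLax1.rarefaction_left {p : ℝ × ℝ} {c : ℝ} (hc : p.2 ≤ c) :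
    OnLax1 p (p.1 + p.2 - c, c) := by
  simpa using onLax1_rarefaction (p := p) hc

theorem OnLax2.rarefaction_left {s : ℝ × ℝ} {c : ℝ} (hc : s.2 ≤ c) :
    OnLax2 s (s.1 - s.2 + c, c) := by
  simpa using onLax2_rarefaction (s := s) hc

theorem OnLax1.rarefaction_right {p s : ℝ × ℝ} (h : OnLax1 p s) (hlt : ¬ p.1 < s.1) {c : ℝ}
    (hc : c ≤ s.2) : OnLax1 (p.1 + p.2 - c, c) s := by
  rw [h.eq_rarefaction hlt]; exact onLax1_rarefaction hc

theorem OnLax2.rarefaction_right {s q : ℝ × ℝ} (h : OnLax2 s q) (hlt : ¬ q.1 < s.1) {c : ℝ}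
    (hc : c ≤ q.2) : OnLax2 (s.1 - s.2 + c, c) q := by
  rw [h.eq_rarefaction hlt]; exact onLax2_rarefaction hc

theorem OnLax1.logWave1_left {p s : ℝ × ℝ} (h : OnLax1 p s) (x : ℝ) :
    OnLax1 p (logWave1 p s x) := by
  rcases logWave1_cases h x with e | e | ⟨-, hx, e⟩ <;> rw [e]
  · exact OnLax1.refl p
  · exact h
  · exact OnLax1.rarefaction_left hx.1

theorem OnLax1.logWave1_right {p s : ℝ × ℝ} (h : OnLax1 p s) (x : ℝ) :
    OnLax1 (logWave1 p s x) s := by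
  rcases logWave1_cases h x with e | e | ⟨hlt, hx, e⟩ <;> rw [e]
  · exact h
  · exact OnLax1.refl s
  · exact h.rarefaction_right hlt.not_gt hx.2

theorem OnLax2.logWave2_left {s q : ℝ × ℝ} (h : OnLax2 s q) (x : ℝ) :
    OnLax2 s (logWave2 s q x) := by
  rcases logWave2_cases h x with e | e | ⟨-, hx, e⟩ <;> rw [e]
  · exact OnLax2.refl s
  · exact h
  · exact OnLax2.rarefaction_left hx.1

theorem OnLax2.logWave2_right {s q : ℝ × ℝ} (h : OnLax2 s q) (x : ℝ) :
    OnLax2 (logWave2 s q x) q := by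
  rcases logWave2_cases h x with e | e | ⟨hlt, hx, e⟩ <;> rw [e]
  · exact h
  · exact OnLax2.refl q
  · exact h.rarefaction_right hlt.not_gt hx.2

/-! ### Consistency of the Lax solver -/

/-- A shock takes only its end values, and a rarefaction cut at an inner state consists of two
rarefactions on the same curve. -/
theorem logWave1_consistent {p s : ℝ × ℝ} (h : OnLax1 p s) (y x : ℝ) :
    logWave1 p (logWave1 p s y) x = (if x < y then logWave1 p s x else logWave1 p s y) ∧
    logWave1 (logWave1 p s y) s x = if x < y then logWave1 p s y else logWave1 p s x := by
  by_cases hlt : p.1 < s.1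
  · have hx : ∀ x, logWave1 p s x = if x < p.2 - Real.exp ((s.1 - p.1) / 2) then p else s :=
      fun x => if_pos hlt
    by_cases hy : y < p.2 - Real.exp ((s.1 - p.1) / 2)
    · have hyp : logWave1 p s y = p := by rw [hx, if_pos hy]
      rw [hyp, logWave1_self, hx x]
      constructor <;> split_ifs <;> first | rfl | (exfalso; linarith)
    · have hys : logWave1 p s y = s := by rw [hx, if_neg hy]
      rw [hys, logWave1_self, hx x]
      constructor <;> split_ifs <;> first | rfl | (exfalso; linarith)
  · have he := h.eq_of_le hlt
    have hx : ∀ x, logWave1 p s x = if x < p.2 - 1 then p else if x < s.2 - 1 then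
      (p.1 + p.2 - (x + 1), x + 1) else s := fun x => if_neg hlt
    by_cases h1 : y < p.2 - 1
    · have hyp : logWave1 p s y = p := by rw [hx, if_pos h1]
      rw [hyp, logWave1_self, hx x]
      constructor <;> split_ifs <;> first | rfl | (exfalso; linarith)
    by_cases h2 : y < s.2 - 1
    · have hym : logWave1 p s y = (p.1 + p.2 - (y + 1), y + 1) := by
        rw [hx, if_neg h1, if_pos h2]
      rw [hym, hx x]
      unfold logWave1
      simp only
      rw [if_neg (show ¬ p.1 < p.1 + p.2 - (y + 1) by linarith),
        if_neg (show ¬ p.1 + p.2 - (y + 1) < s.1 by linarith)]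
      constructor <;> split_ifs <;> first | rfl | (exfalso; linarith) |
        (ext <;> first | rfl | (simp only; linarith))
    · have hys : logWave1 p s y = s := by rw [hx, if_neg h1, if_neg h2]
      rw [hys, logWave1_self, hx x]
      constructor <;> split_ifs <;> first | rfl | (exfalso; linarith)

theorem logWave2_consistent {s q : ℝ × ℝ} (h : OnLax2 s q) (y x : ℝ) :
    logWave2 s (logWave2 s q y) x = (if x < y then logWave2 s q x else logWave2 s q y) ∧
    logWave2 (logWave2 s q y) q x = if x < y then logWave2 s q y else logWave2 s q x := by
  by_cases hlt : q.1 < s.1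
  · have hx : ∀ x, logWave2 s q x = if x < q.2 + Real.exp ((s.1 - q.1) / 2) then s else q :=
      fun x => if_pos hlt
    by_cases hy : y < q.2 + Real.exp ((s.1 - q.1) / 2)
    · have hyp : logWave2 s q y = s := by rw [hx, if_pos hy]
      rw [hyp, logWave2_self, hx x]
      constructor <;> split_ifs <;> first | rfl | (exfalso; linarith)
    · have hys : logWave2 s q y = q := by rw [hx, if_neg hy]
      rw [hys, logWave2_self, hx x]
      constructor <;> split_ifs <;> first | rfl | (exfalso; linarith)
  · have he := h.eq_of_le hlt
    have hx : ∀ x, logWave2 s q x = if x < s.2 + 1 then s else if x < q.2 + 1 then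
      (s.1 - s.2 + (x - 1), x - 1) else q := fun x => if_neg hlt
    by_cases h1 : y < s.2 + 1
    · have hyp : logWave2 s q y = s := by rw [hx, if_pos h1]
      rw [hyp, logWave2_self, hx x]
      constructor <;> split_ifs <;> first | rfl | (exfalso; linarith)
    by_cases h2 : y < q.2 + 1
    · have hym : logWave2 s q y = (s.1 - s.2 + (y - 1), y - 1) := by
        rw [hx, if_neg h1, if_pos h2]
      rw [hym, hx x]
      unfold logWave2
      simp only
      rw [if_neg (show ¬ s.1 - s.2 + (y - 1) < s.1 by linarith),
        if_neg (show ¬ q.1 < s.1 - s.2 + (y - 1) by linarith)]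
      constructor <;> split_ifs <;> first | rfl | (exfalso; linarith) |
        (ext <;> first | rfl | (simp only; linarith))
    · have hys : logWave2 s q y = q := by rw [hx, if_neg h1, if_neg h2]
      rw [hys, logWave2_self, hx x]
      constructor <;> split_ifs <;> first | rfl | (exfalso; linarith)

theorem logLax_eq_logWave1 {p s : ℝ × ℝ} (h : OnLax1 p s) (x : ℝ) :
    logLax p s x = logWave1 p s x := by
  rw [logLax, middle_eq_right h, logWave2_self]
  split_ifs with hx
  · rfl
  · exact (logWave1_of_le h (not_lt.1 hx)).symm

theorem logLax_eq_logWave2 {s q : ℝ × ℝ} (h : OnLax2 s q) (x : ℝ) :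
    logLax s q x = logWave2 s q x := by
  rw [logLax, middle_eq_left h, logWave1_self]
  split_ifs with hx
  · exact (logWave2_of_le h hx.le).symm
  · rfl

/-- A value v taken in the first wave still has s on its 1-curve, so (v, q) has the same middle
state, while (p, v) is a pure 1-wave. The second wave is symmetric. -/
theorem logLax_consistent (p q : ℝ × ℝ) (y x : ℝ) :
    logLax p (logLax p q y) x = (if x < y then logLax p q x else logLax p q y) ∧
    logLax (logLax p q y) q x = if x < y then logLax p q y else logLax p q x := by
  have h1 := onLax1_middle p q
  have h2 := onLax2_middle p q
  have hx : ∀ x, logLax p q x = if x < (middle p q).2 then logWave1 p (middle p q) x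
    else logWave2 (middle p q) q x := fun x => rfl
  generalize middle p q = s at h1 h2 hx
  by_cases hy : y < s.2
  · obtain ⟨c1, c2⟩ := logWave1_consistent h1 y x
    rw [hx y, if_pos hy, logLax_eq_logWave1 (h1.logWave1_left y), c1, hx x]
    refine ⟨by split_ifs <;> first | rfl | (exfalso; linarith), ?_⟩
    rw [logLax, middle_eq (h1.logWave1_right y) h2, c2]
    split_ifs <;> first | rfl | (exfalso; linarith)
  · obtain ⟨c1, c2⟩ := logWave2_consistent h2 y x
    rw [hx y, if_neg hy, logLax_eq_logWave2 (h2.logWave2_right y), c2, hx x]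
    refine ⟨?_, by split_ifs <;> first | rfl | (exfalso; linarith)⟩
    rw [logLax, middle_eq h1 (h2.logWave2_left y), c1]
    split_ifs <;> first | rfl | (exfalso; linarith)

/-! ### Traces at the interface -/

/-- The three branches of a rarefaction merge into one formula, visibly continuous in x and in the
data. -/
theorem logWave1_eq_clamp {p s : ℝ × ℝ} (h : OnLax1 p s) (hlt : ¬ p.1 < s.1) (x : ℝ) :
    logWave1 p s x =
      (p.1 + p.2 - max p.2 (min (x + 1) s.2), max p.2 (min (x + 1) s.2)) := by
  have he := h.eq_of_le hlt
  rw [logWave1, if_neg hlt]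
  split_ifs with h1 h2
  · rw [max_eq_left ((min_le_left _ _).trans (by linarith))]
    simp
  · rw [min_eq_left (by linarith), max_eq_right (by linarith)]
  · rw [min_eq_right (by linarith), max_eq_right (by linarith)]
    exact h.eq_rarefaction hlt

theorem logWave2_eq_clamp {s q : ℝ × ℝ} (h : OnLax2 s q) (hlt : ¬ q.1 < s.1) (x : ℝ) :
    logWave2 s q x =
      (s.1 - s.2 + max s.2 (min (x - 1) q.2), max s.2 (min (x - 1) q.2)) := by
  have he := h.eq_of_le hlt
  rw [logWave2, if_neg hlt]
  split_ifs with h1 h2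
  · rw [max_eq_left ((min_le_left _ _).trans (by linarith))]
    simp
  · rw [min_eq_left (by linarith), max_eq_right (by linarith)]
  · rw [min_eq_right (by linarith), max_eq_right (by linarith)]
    exact h.eq_rarefaction hlt

/-- One-sided limits of a step function. -/
theorem step_traces {E : Type*} [TopologicalSpace E] {f : ℝ → E} {c : ℝ} {u v : E}
    (hf : ∀ x, f x = if x < c then u else v) (y : ℝ) :
    Tendsto f (𝓝[>] y) (𝓝 (f y)) ∧ ∃ l, Tendsto f (𝓝[<] y) (𝓝 l) ∧
      (l = f y ∨ y = c ∧ l = u ∧ f y = v) := by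
  rcases lt_trichotomy y c with h | h | h
  · have : f =ᶠ[𝓝 y] fun _ => f y := by
      filter_upwards [Iio_mem_nhds h] with x hx
      rw [hf, hf, if_pos (mem_Iio.1 hx), if_pos h]
    have ht : Tendsto f (𝓝 y) (𝓝 (f y)) := tendsto_const_nhds.congr' this.symm
    exact ⟨ht.mono_left nhdsWithin_le_nhds, f y, ht.mono_left nhdsWithin_le_nhds, Or.inl rfl⟩
  · subst h
    have hy : f y = v := by rw [hf, if_neg (lt_irrefl y)]
    refine ⟨?_, u, ?_, Or.inr ⟨rfl, rfl, hy⟩⟩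
    · refine tendsto_const_nhds.congr' ?_
      filter_upwards [self_mem_nhdsWithin] with x hx
      rw [hf x, hy, if_neg (not_lt.2 (le_of_lt hx))]
    · refine tendsto_const_nhds.congr' ?_
      filter_upwards [self_mem_nhdsWithin] with x hx
      rw [hf x, if_pos (mem_Iio.1 hx)]
  · have : f =ᶠ[𝓝 y] fun _ => f y := by
      filter_upwards [Ioi_mem_nhds h] with x hx
      rw [hf, hf, if_neg (not_lt.2 (le_of_lt hx)), if_neg (not_lt.2 h.le)]
    have ht : Tendsto f (𝓝 y) (𝓝 (f y)) := tendsto_const_nhds.congr' this.symm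
    exact ⟨ht.mono_left nhdsWithin_le_nhds, f y, ht.mono_left nhdsWithin_le_nhds, Or.inl rfl⟩

theorem logWave1_traces {p s : ℝ × ℝ} (h : OnLax1 p s) (y : ℝ) :
    Tendsto (logWave1 p s) (𝓝[>] y) (𝓝 (logWave1 p s y)) ∧
    ∃ l, Tendsto (logWave1 p s) (𝓝[<] y) (𝓝 l) ∧
      (l = logWave1 p s y ∨
        p.1 < s.1 ∧ y = p.2 - Real.exp ((s.1 - p.1) / 2) ∧ l = p ∧ logWave1 p s y = s) := by
  by_cases hlt : p.1 < s.1
  · simpa only [hlt, true_and] using step_traces (f := logWave1 p s) (fun x => if_pos hlt) y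
  · have hc : Continuous (logWave1 p s) := by
      rw [funext (logWave1_eq_clamp h hlt)]; fun_prop
    exact ⟨hc.continuousWithinAt, _, hc.continuousWithinAt, Or.inl rfl⟩

theorem logWave2_traces {s q : ℝ × ℝ} (h : OnLax2 s q) (y : ℝ) :
    Tendsto (logWave2 s q) (𝓝[>] y) (𝓝 (logWave2 s q y)) ∧
    ∃ l, Tendsto (logWave2 s q) (𝓝[<] y) (𝓝 l) ∧
      (l = logWave2 s q y ∨
        q.1 < s.1 ∧ y = q.2 + Real.exp ((s.1 - q.1) / 2) ∧ l = s ∧ logWave2 s q y = q) := by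
  by_cases hlt : q.1 < s.1
  · simpa only [hlt, true_and] using step_traces (f := logWave2 s q) (fun x => if_pos hlt) y
  · have hc : Continuous (logWave2 s q) := by
      rw [funext (logWave2_eq_clamp h hlt)]; fun_prop
    exact ⟨hc.continuousWithinAt, _, hc.continuousWithinAt, Or.inl rfl⟩

theorem logLax_self (p : ℝ × ℝ) (x : ℝ) : logLax p p x = p := by
  rw [logLax_eq_logWave1 (OnLax1.refl p), logWave1_self]

/-- Inside a wave of the first family that is overtaken by the flow, the gas is at rest nowhere on
the ray `x = 0`. -/
theorem logWave1_zero_snd_ne {p s : ℝ × ℝ} (hs : 0 < s.2) :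
    (logWave1 p s 0).2 ≠ 0 := by
  unfold logWave1
  split_ifs with h1 h2 h2 h3
  · have := Real.exp_pos ((s.1 - p.1) / 2); intro h; linarith
  · exact hs.ne'
  · intro h; linarith
  · simp
  · exact hs.ne'

theorem logWave2_zero_snd_ne {s q : ℝ × ℝ} (h : OnLax2 s q) (hs : s.2 < 0) :
    (logWave2 s q 0).2 ≠ 0 := by
  unfold logWave2
  split_ifs with h1 h2 h2 h3
  · exact hs.ne
  · exact ((h.snd_lt h1).trans hs).ne
  · exact hs.ne
  · simp
  · intro h; linarith

/-- The Lax solution has traces at `0`, which are coherent; if the gas is at rest on both sides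
of `0` then the middle state is at rest. -/
theorem logLax_traces (p q : ℝ × ℝ) :
    ∃ l r, Tendsto (logLax p q) (𝓝[<] 0) (𝓝 l) ∧ Tendsto (logLax p q) (𝓝[>] 0) (𝓝 r) ∧
      (∀ x, logLax l r x = if x < 0 then l else r) ∧
      (l.2 = 0 → r.2 = 0 → (middle p q).2 = 0) := by
  have h1 := onLax1_middle p q
  have h2 := onLax2_middle p q
  have hx : ∀ x, logLax p q x = if x < (middle p q).2 then logWave1 p (middle p q) x
    else logWave2 (middle p q) q x := fun x => rfl
  generalize middle p q = s at h1 h2 hx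
  -- The velocity of the middle state separates the two waves, so its sign decides which wave
  -- contains the ray x = 0.
  rcases lt_trichotomy 0 s.2 with hs | hs | hs
  · have he : logWave1 p s =ᶠ[𝓝 0] logLax p q := by
      filter_upwards [Iio_mem_nhds hs] with x h
      rw [hx, if_pos (mem_Iio.1 h)]
    obtain ⟨tr, l, tl, hl⟩ := logWave1_traces h1 0
    refine ⟨l, _, tl.congr' (he.filter_mono nhdsWithin_le_nhds),
      tr.congr' (he.filter_mono nhdsWithin_le_nhds), ?_, ?_⟩
    · intro x
      rcases hl with rfl | ⟨hlt, h0, rfl, hr⟩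
      · simp [logLax_self]
      -- The shock is stationary: its two states are the traces, and their Riemann problem is solved
      -- by the same shock at speed 0.
      · rw [hr, logLax_eq_logWave1 h1, logWave1, if_pos hlt, h0]
    · intro _ hr
      exact absurd hr (logWave1_zero_snd_ne hs)
  · obtain ⟨y1, hy1, H1⟩ := logWave1_eventually_eq h1
    obtain ⟨y2, hy2, H2⟩ := logWave2_eventually_eq h2
    have he : (fun _ => s) =ᶠ[𝓝 0] logLax p q := by
      filter_upwards [Ioo_mem_nhds (hs ▸ hy1) (hs ▸ hy2)] with x h
      rw [hx, H1 x h.1.le, H2 x h.2, ite_self]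
    have ht : Tendsto (logLax p q) (𝓝 0) (𝓝 s) := tendsto_const_nhds.congr' he
    exact ⟨s, s, ht.mono_left nhdsWithin_le_nhds, ht.mono_left nhdsWithin_le_nhds,
      by simp [logLax_self], fun _ _ => hs.symm⟩
  · have he : logWave2 s q =ᶠ[𝓝 0] logLax p q := by
      filter_upwards [Ioi_mem_nhds hs] with x h
      rw [hx, if_neg (not_lt.2 (le_of_lt h))]
    obtain ⟨tr, l, tl, hl⟩ := logWave2_traces h2 0
    refine ⟨l, _, tl.congr' (he.filter_mono nhdsWithin_le_nhds),
      tr.congr' (he.filter_mono nhdsWithin_le_nhds), ?_, ?_⟩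
    · intro x
      rcases hl with rfl | ⟨hlt, h0, rfl, hr⟩
      · simp [logLax_self]
      · rw [hr, logLax_eq_logWave2 h2, logWave2, if_pos hlt, h0]
    · intro _ hr
      exact absurd hr (logWave2_zero_snd_ne h2 hs)

/-! ### The valve in logarithmic coordinates -/

theorem logValve_of_le {K : ℝ} {p q : ℝ × ℝ} (h : logJump p q ≤ K) (x : ℝ) :
    logValve K p q x =
      if x < 0 then logWave1 p (wallHat p) x else logWave2 (wallCheck q) q x := if_pos h

theorem logValve_of_lt {K : ℝ} {p q : ℝ × ℝ} (h : K < logJump p q) :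
    logValve K p q = logLax p q := funext fun _ => if_neg h.not_ge

/-- A 1-wave ending at rest has completed at some negative speed, so the profile is constant just
left of 0. -/
theorem logValve_tendsto_left {K : ℝ} {p q : ℝ × ℝ} (h : logJump p q ≤ K) :
    Tendsto (logValve K p q) (𝓝[<] 0) (𝓝 (wallHat p)) := by
  obtain ⟨y, hy, H⟩ := logWave1_eventually_eq (onLax1_wallHat p)
  refine tendsto_const_nhds.congr' ?_
  filter_upwards [self_mem_nhdsWithin, nhdsWithin_le_nhds (Ioi_mem_nhds (show y < 0 from hy))]
    with x hx hxy
  rw [logValve_of_le h, if_pos (mem_Iio.1 hx), H x (le_of_lt hxy)]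

theorem logValve_tendsto_right {K : ℝ} {p q : ℝ × ℝ} (h : logJump p q ≤ K) :
    Tendsto (logValve K p q) (𝓝[>] 0) (𝓝 (wallCheck q)) := by
  obtain ⟨y, hy, H⟩ := logWave2_eventually_eq (onLax2_wallCheck q)
  refine tendsto_const_nhds.congr' ?_
  filter_upwards [self_mem_nhdsWithin, nhdsWithin_le_nhds (Iio_mem_nhds (show 0 < y from hy))]
    with x hx hxy
  rw [logValve_of_le h, if_neg (not_lt.2 (le_of_lt hx)), H x hxy]

theorem wallHat_eq_of_onLax1 {p s : ℝ × ℝ} (h : OnLax1 s (wallHat p)) : wallHat s = wallHat p :=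
  (eq_wallHat h rfl).symm

theorem wallCheck_eq_of_onLax2 {s q : ℝ × ℝ} (h : OnLax2 (wallCheck q) s) :
    wallCheck s = wallCheck q := (eq_wallCheck h rfl).symm

theorem wallHat_wallHat (p : ℝ × ℝ) : wallHat (wallHat p) = wallHat p :=
  wallHat_eq_of_onLax1 (OnLax1.refl _)

theorem wallCheck_wallCheck (q : ℝ × ℝ) : wallCheck (wallCheck q) = wallCheck q :=
  wallCheck_eq_of_onLax2 (OnLax2.refl _)

/-- A middle state at rest lies on both Lax curves, hence is the wall state of each side. -/
theorem logJump_eq_zero {p q : ℝ × ℝ} (h : (middle p q).2 = 0) : logJump p q = 0 := by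
  rw [logJump, ← eq_wallHat (onLax1_middle p q) h, ← eq_wallCheck (onLax2_middle p q) h]
  simp

/-- The valve does not affect the Lax solution. -/
def Unaffected (K : ℝ) (p q : ℝ × ℝ) : Prop := (middle p q).2 ≠ 0 → K < logJump p q

theorem middle_snd_eq_zero {p q : ℝ × ℝ}
    (hl : Tendsto (logLax p q) (𝓝[<] 0) (𝓝 (wallHat p)))
    (hr : Tendsto (logLax p q) (𝓝[>] 0) (𝓝 (wallCheck q))) : (middle p q).2 = 0 := by
  obtain ⟨l, r, tl, tr, -, h0⟩ := logLax_traces p q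
  rw [tendsto_nhds_unique tl hl, tendsto_nhds_unique tr hr] at h0
  exact h0 rfl rfl

/-- If the closed solution agrees with the Lax one, the Lax traces are the walls, both at rest, so
the middle state is at rest. Conversely, a middle state at rest is both walls, and the two formulas
coincide. -/
theorem unaffected_iff {K : ℝ} {p q : ℝ × ℝ} :
    Unaffected K p q ↔ ∀ x, logValve K p q x = logLax p q x := by
  constructor
  · intro h x
    rcases lt_or_ge K (logJump p q) with hK | hK
    · rw [logValve_of_lt hK]
    · have h0 : (middle p q).2 = 0 := by
        by_contra h0
        exact absurd (h h0) hK.not_gt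
      rw [logValve_of_le hK, logLax, h0, ← eq_wallHat (onLax1_middle p q) h0,
        ← eq_wallCheck (onLax2_middle p q) h0]
  · intro h h0
    by_contra hK
    have e : logValve K p q = logLax p q := funext h
    exact h0 (middle_snd_eq_zero (e ▸ logValve_tendsto_left (not_lt.1 hK))
      (e ▸ logValve_tendsto_right (not_lt.1 hK)))

/-- For a closed valve the traces are walls, whose own walls are themselves. For an open valve the
Lax traces are coherent for the Lax solver, so the only question is whether they close the valve. -/
theorem logValve_coherent_iff {K : ℝ} (hK : 0 ≤ K) {p q l r : ℝ × ℝ}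
    (hl : Tendsto (logValve K p q) (𝓝[<] 0) (𝓝 l))
    (hr : Tendsto (logValve K p q) (𝓝[>] 0) (𝓝 r)) :
    (∀ x, logValve K l r x = if x < 0 then l else r) ↔
      logJump p q ≤ K ∨ K < logJump p q ∧ K < logJump l r := by
  rcases le_or_gt (logJump p q) K with h | h
  · rw [tendsto_nhds_unique hl (logValve_tendsto_left h),
      tendsto_nhds_unique hr (logValve_tendsto_right h)]
    have h' : logJump (wallHat p) (wallCheck q) ≤ K := by
      rwa [logJump, wallHat_wallHat, wallCheck_wallCheck]
    simp only [h, true_or, iff_true]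
    intro x
    rw [logValve_of_le h', wallHat_wallHat, wallCheck_wallCheck, logWave1_self, logWave2_self]
  · simp only [h, h.not_ge, false_or, true_and]
    rw [logValve_of_lt h] at hl hr
    obtain ⟨l', r', tl, tr, hc, h0⟩ := logLax_traces p q
    obtain rfl := tendsto_nhds_unique tl hl
    obtain rfl := tendsto_nhds_unique tr hr
    constructor
    · intro H
      by_contra hj
      have hj := not_lt.1 hj
      -- A closed valve has its walls as traces; comparison with the two-state profile puts l' and
      -- r' at rest, which forces jump 0 for (p, q).
      have e1 : l' = wallHat l' := by
        refine tendsto_nhds_unique (tendsto_const_nhds.congr' ?_) (logValve_tendsto_left hj)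
        filter_upwards [self_mem_nhdsWithin] with x hx
        rw [H, if_pos (mem_Iio.1 hx)]
      have e2 : r' = wallCheck r' := by
        refine tendsto_nhds_unique (tendsto_const_nhds.congr' ?_) (logValve_tendsto_right hj)
        filter_upwards [self_mem_nhdsWithin] with x hx
        rw [H, if_neg (not_lt.2 (le_of_lt hx))]
      have := logJump_eq_zero (h0 (by rw [e1]; rfl) (by rw [e2]; rfl))
      linarith
    · intro H x
      rw [logValve_of_lt H, hc]

/-! ### Consistency of the valve -/

/-- Consistency of the valve solver at `(p, q)`. -/
def LogConsistent (K : ℝ) (p q : ℝ × ℝ) : Prop := ∀ y,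
  (∀ x, logValve K p (logValve K p q y) x =
    if x < y then logValve K p q x else logValve K p q y) ∧
  ∀ x, logValve K (logValve K p q y) q x =
    if x < y then logValve K p q y else logValve K p q x

/-- Lax consistency identifies the prescribed subprofiles with Lax solutions, and agreement of the
valve with those is `unaffected_iff`. -/
theorem logConsistent_iff_of_unaffected {K : ℝ} {p q : ℝ × ℝ} (h : Unaffected K p q) :
    LogConsistent K p q ↔
      ∀ y, Unaffected K p (logValve K p q y) ∧ Unaffected K (logValve K p q y) q := by
  have e : logValve K p q = logLax p q := funext (unaffected_iff.1 h)
  simp only [LogConsistent, unaffected_iff, e, (logLax_consistent p q _ _).1,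
    (logLax_consistent p q _ _).2]

/-- Cutting left of the valve leaves one subproblem that must be a pure 1-wave, and one that still
ends at the same wall and is therefore closed automatically. Cutting right of it is symmetric. -/
theorem logConsistent_iff_of_le {K : ℝ} {p q : ℝ × ℝ} (h : logJump p q ≤ K) :
    LogConsistent K p q ↔ (∀ y < 0, Unaffected K p (logWave1 p (wallHat p) y)) ∧
      ∀ y, 0 ≤ y → Unaffected K (logWave2 (wallCheck q) q y) q := by
  have h1 := onLax1_wallHat p
  have h2 := onLax2_wallCheck q
  have hv := logValve_of_le h
  constructor
  · intro H
    refine ⟨fun y hy => unaffected_iff.2 fun x => ?_, fun y hy => unaffected_iff.2 fun x => ?_⟩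
    · have := (H y).1 x
      rw [hv y, if_pos hy, hv x] at this
      rw [this, logLax_eq_logWave1 (h1.logWave1_left y), (logWave1_consistent h1 y x).1]
      split_ifs <;> first | rfl | (exfalso; linarith)
    · have := (H y).2 x
      rw [hv y, if_neg hy.not_gt, hv x] at this
      rw [this, logLax_eq_logWave2 (h2.logWave2_right y), (logWave2_consistent h2 y x).2]
      split_ifs <;> first | rfl | (exfalso; linarith)
  · rintro ⟨H1, H2⟩ y
    rcases lt_or_ge y 0 with hy | hy
    · rw [hv y, if_pos hy]
      refine ⟨fun x => ?_, fun x => ?_⟩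
      · rw [unaffected_iff.1 (H1 y hy), logLax_eq_logWave1 (h1.logWave1_left y),
          (logWave1_consistent h1 y x).1, hv x]
        split_ifs <;> first | rfl | (exfalso; linarith)
      -- The cut state has the same wall as p, so the jump is unchanged and the valve stays closed.
      · have hw := wallHat_eq_of_onLax1 (h1.logWave1_right y)
        rw [logValve_of_le (by rwa [logJump, hw]), hw, (logWave1_consistent h1 y x).2, hv x]
        split_ifs <;> first | rfl | (exfalso; linarith)
    · rw [hv y, if_neg hy.not_gt]
      refine ⟨fun x => ?_, fun x => ?_⟩
      · have hw := wallCheck_eq_of_onLax2 (h2.logWave2_left y)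
        rw [logValve_of_le (by rwa [logJump, hw]), hw, (logWave2_consistent h2 y x).1, hv x]
        split_ifs <;> first | rfl | (exfalso; linarith)
      · rw [unaffected_iff.1 (H2 y hy), logLax_eq_logWave2 (h2.logWave2_right y),
          (logWave2_consistent h2 y x).2, hv x]
        split_ifs <;> first | rfl | (exfalso; linarith)

/-- Along a rarefaction of the first family the jump is small near the state at rest. -/
theorem eventually_logJump_rarefaction1_lt {K : ℝ} (hK : 0 < K) {p : ℝ × ℝ} (hp : p.2 ≤ 0) :
    ∀ᶠ c in 𝓝 (0 : ℝ), logJump p (p.1 + p.2 - c, c) < K := by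
  have hc : Continuous fun c : ℝ => logJump p (p.1 + p.2 - c, c) := by
    have := profInv_continuous
    unfold logJump wallCheck
    fun_prop
  refine hc.continuousAt.eventually_lt continuousAt_const ?_
  simpa [logJump, wallHat, wallCheck, profInv_of_nonpos hp, profInv_zero] using hK

theorem eventually_logJump_rarefaction2_lt {K : ℝ} (hK : 0 < K) {q : ℝ × ℝ} (hq : 0 ≤ q.2) :
    ∀ᶠ c in 𝓝 (0 : ℝ), logJump (q.1 - q.2 + c, c) q < K := by
  have hc : Continuous fun c : ℝ => logJump (q.1 - q.2 + c, c) q := by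
    have := profInv_continuous
    unfold logJump wallHat
    fun_prop
  refine hc.continuousAt.eventually_lt continuousAt_const ?_
  simpa [logJump, wallHat, wallCheck, profInv_of_nonpos (neg_nonpos.2 hq), profInv_zero,
    ← sub_eq_add_neg] using hK

theorem unaffected_of_middle {K : ℝ} {p q : ℝ × ℝ} (h : (middle p q).2 = 0) : Unaffected K p q :=
  fun h' => absurd h h'

theorem unaffected_of_lt {K : ℝ} {p q : ℝ × ℝ} (h : K < logJump p q) : Unaffected K p q :=
  fun _ => h

/-- For p.2 < 0 the gas reaches rest through a rarefaction, whose last states are nearly at rest and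
close the valve. For p.2 ≥ 0 the wave is a shock or null, so only its end states need checking. -/
theorem unaffected_logWave1_wallHat_iff {K : ℝ} (hK : 0 < K) {p : ℝ × ℝ} :
    (∀ y < 0, Unaffected K p (logWave1 p (wallHat p) y)) ↔ 0 ≤ p.2 ∧ Unaffected K p p := by
  constructor
  · intro H
    refine ⟨?_, ?_⟩
    · by_contra hp
      rw [not_le] at hp
      have hh : wallHat p = (p.1 + p.2, 0) := by rw [wallHat, profInv_of_nonpos hp.le]
      -- The velocity c is slightly negative: the jump is below K, but the middle state of the
      -- subproblem is the state of velocity c, not at rest.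
      obtain ⟨c, hj, hc⟩ := ((eventually_nhdsWithin_of_eventually_nhds
        (eventually_logJump_rarefaction1_lt hK hp.le)).and (Ioo_mem_nhdsLT hp)).exists
      have hw : logWave1 p (wallHat p) (c - 1) = (p.1 + p.2 - c, c) := by
        rw [logWave1_eq_clamp (onLax1_wallHat p) (by rw [hh]; simpa using hp.le), sub_add_cancel,
          hh, min_eq_left hc.2.le, max_eq_right hc.1.le]
      have := H (c - 1) (by linarith [hc.2])
      rw [hw, Unaffected, middle_eq_right (OnLax1.rarefaction_left hc.1.le)] at this
      exact lt_asymm hj (this hc.2.ne)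
    · obtain ⟨x, hx, e⟩ := exists_logWave1_eq_left p (wallHat p) 0
      simpa [e] using H x hx
  · rintro ⟨hp, H⟩ y -
    rcases logWave1_cases (onLax1_wallHat p) y with e | e | ⟨hlt, -⟩
    · rwa [e]
    · rw [e]
      exact unaffected_of_middle (by rw [middle_eq_right (onLax1_wallHat p)]; rfl)
    · have := profInv_strictMono.monotone hp
      rw [profInv_zero] at this
      simp only [wallHat] at hlt
      linarith

theorem unaffected_logWave2_wallCheck_iff {K : ℝ} (hK : 0 < K) {q : ℝ × ℝ} :
    (∀ y, 0 ≤ y → Unaffected K (logWave2 (wallCheck q) q y) q) ↔ q.2 ≤ 0 ∧ Unaffected K q q := by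
  constructor
  · intro H
    refine ⟨?_, ?_⟩
    · by_contra hq
      rw [not_le] at hq
      have hh : wallCheck q = (q.1 - q.2, 0) := by
        rw [wallCheck, profInv_of_nonpos (by linarith), ← sub_eq_add_neg]
      obtain ⟨c, hj, hc⟩ := ((eventually_nhdsWithin_of_eventually_nhds
        (eventually_logJump_rarefaction2_lt hK hq.le)).and (Ioo_mem_nhdsGT hq)).exists
      have hw : logWave2 (wallCheck q) q (c + 1) = (q.1 - q.2 + c, c) := by
        rw [logWave2_eq_clamp (onLax2_wallCheck q) (by rw [hh]; simpa using hq.le),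
          add_sub_cancel_right, hh, min_eq_left hc.2.le, max_eq_right hc.1.le, sub_zero]
      have := H (c + 1) (by linarith [hc.1])
      have hl : OnLax2 (q.1 - q.2 + c, c) q := by
        simpa using onLax2_rarefaction (s := q) hc.2.le
      rw [hw, Unaffected, middle_eq_left hl] at this
      exact lt_asymm hj (this hc.1.ne')
    · obtain ⟨x, hx, e⟩ := exists_logWave2_eq_right (onLax2_wallCheck q) 0
      simpa [e] using H x hx
  · rintro ⟨hq, H⟩ y -
    rcases logWave2_cases (onLax2_wallCheck q) y with e | e | ⟨hlt, -⟩
    · rw [e]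
      exact unaffected_of_middle (by rw [middle_eq_left (onLax2_wallCheck q)]; rfl)
    · rwa [e]
    · have := profInv_strictMono.monotone (neg_nonneg.2 hq)
      rw [profInv_zero] at this
      simp only [wallCheck] at hlt
      linarith

/-! ### Monotonicity of the jump along rarefactions -/

theorem lt_abs_exp_sub {K α β α' β' : ℝ} (h : K < |Real.exp α - Real.exp β|) (hαβ : α ≤ β)
    (hα : α' ≤ α) (hβ : β ≤ β') : K < |Real.exp α' - Real.exp β'| := by
  have h1 := Real.exp_le_exp.2 hαβ
  have h2 := Real.exp_le_exp.2 hα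
  have h3 := Real.exp_le_exp.2 hβ
  rw [abs_of_nonpos (by linarith)] at h ⊢
  linarith

theorem lt_abs_exp_sub_rev {K α β α' β' : ℝ} (h : K < |Real.exp α - Real.exp β|) (hαβ : β ≤ α)
    (hα : α ≤ α') (hβ : β' ≤ β) : K < |Real.exp α' - Real.exp β'| := by
  rw [abs_sub_comm] at h ⊢
  exact lt_abs_exp_sub h hαβ hβ hα

/-- Density decreases with velocity along a 1-curve, so the sign of the velocity tells on which side
of the wall state s lies. The next three lemmas are variants. -/
theorem OnLax1.le_wallHat {p s : ℝ × ℝ} (h : OnLax1 p s) (hs : 0 ≤ s.2) :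
    s.1 ≤ (wallHat p).1 := by
  have h' := onLax1_wallHat p
  unfold OnLax1 at h h'
  have : prof (s.1 - p.1) ≤ prof ((wallHat p).1 - p.1) := by
    simp only [wallHat] at h' ⊢; linarith
  linarith [prof_strictMono.le_iff_le.1 this]

theorem OnLax1.wallHat_le {p s : ℝ × ℝ} (h : OnLax1 p s) (hs : s.2 ≤ 0) :
    (wallHat p).1 ≤ s.1 := by
  have h' := onLax1_wallHat p
  unfold OnLax1 at h h'
  have : prof ((wallHat p).1 - p.1) ≤ prof (s.1 - p.1) := by
    simp only [wallHat] at h' ⊢; linarith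
  linarith [prof_strictMono.le_iff_le.1 this]

theorem OnLax2.le_wallCheck {s q : ℝ × ℝ} (h : OnLax2 s q) (hs : s.2 ≤ 0) :
    s.1 ≤ (wallCheck q).1 := by
  have h' := onLax2_wallCheck q
  unfold OnLax2 at h h'
  have : prof (s.1 - q.1) ≤ prof ((wallCheck q).1 - q.1) := by
    simp only [wallCheck] at h' ⊢; linarith
  linarith [prof_strictMono.le_iff_le.1 this]

theorem OnLax2.wallCheck_le {s q : ℝ × ℝ} (h : OnLax2 s q) (hs : 0 ≤ s.2) :
    (wallCheck q).1 ≤ s.1 := by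
  have h' := onLax2_wallCheck q
  unfold OnLax2 at h h'
  have : prof ((wallCheck q).1 - q.1) ≤ prof (s.1 - q.1) := by
    simp only [wallCheck] at h' ⊢; linarith
  linarith [prof_strictMono.le_iff_le.1 this]

/-- If the valve is open at both ends of a rarefaction of the first family without states at rest,
it is open along the rarefaction. -/
theorem lt_logJump_rarefaction1 {K : ℝ} {p q s : ℝ × ℝ} (h1 : OnLax1 p s) (h2 : OnLax2 s q)
    (hlt : s.1 < p.1) (h0 : ∀ c ∈ Icc p.2 s.2, c ≠ 0) (hpq : K < logJump p q)
    (hpp : K < logJump p p) (hps : K < logJump p s) (hsq : K < logJump s q) {c : ℝ}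
    (hc : c ∈ Icc p.2 s.2) :
    K < logJump p (p.1 + p.2 - c, c) ∧ K < logJump (p.1 + p.2 - c, c) q := by
  obtain ⟨hc1, hc2⟩ := hc
  have he := h1.eq_of_le hlt.not_gt
  -- The velocity does not vanish on the rarefaction, hence has constant sign.
  rcases lt_or_ge 0 p.2 with hp | hp
  · constructor
    -- For positive velocities the check-wall of the running state lies below the hat-wall of p and
    -- moves down as c grows, so the jump is smallest at p.
    · refine lt_abs_exp_sub hpp ?_ ?_ le_rfl
      · have := profInv_strictMono.monotone (show -p.2 ≤ p.2 by linarith)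
        simpa [wallHat, wallCheck] using this
      · have := profInv_strictMono.monotone (show -c ≤ -p.2 by linarith)
        simp only [wallCheck]
        linarith
    -- Here the hat-wall of the running state decreases in c, because `profInv` is 1-Lipschitz, and
    -- stays above the check-wall of q; the jump is smallest at s.
    · refine lt_abs_exp_sub hsq ?_ le_rfl ?_
      · exact (h2.wallCheck_le (by linarith)).trans ((OnLax1.refl s).le_wallHat (by linarith))
      · have := profInv_sub_le hc2
        simp only [wallHat]
        linarith
  · have hs : s.2 < 0 := by
      by_contra hs
      exact h0 0 ⟨hp, not_lt.1 hs⟩ rfl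
    constructor
    · refine lt_abs_exp_sub_rev hps ?_ ?_ le_rfl
      · exact (h1.wallHat_le hs.le).trans ((OnLax2.refl s).le_wallCheck hs.le)
      · have := profInv_strictMono.monotone (show -s.2 ≤ -c by linarith)
        simp only [wallCheck]
        linarith
    -- For nonpositive velocities the wall is reached by prolonging the same rarefaction, so it does
    -- not move and the jump equals that of (p, q).
    · have : wallHat (p.1 + p.2 - c, c) = wallHat p := by
        simp only [wallHat, profInv_of_nonpos hp, profInv_of_nonpos (hc2.trans hs.le),
          sub_add_cancel]
      rwa [logJump, this]

/-- If the valve is open at both ends of a rarefaction of the second family without states at rest,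
it is open along the rarefaction. -/
theorem lt_logJump_rarefaction2 {K : ℝ} {p q s : ℝ × ℝ} (h1 : OnLax1 p s) (h2 : OnLax2 s q)
    (hlt : s.1 < q.1) (h0 : ∀ c ∈ Icc s.2 q.2, c ≠ 0) (hpq : K < logJump p q)
    (hqq : K < logJump q q) (hps : K < logJump p s) (hsq : K < logJump s q) {c : ℝ}
    (hc : c ∈ Icc s.2 q.2) :
    K < logJump p (s.1 - s.2 + c, c) ∧ K < logJump (s.1 - s.2 + c, c) q := by
  obtain ⟨hc1, hc2⟩ := hc
  have he := h2.eq_of_le hlt.not_gt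
  rcases lt_or_ge q.2 0 with hq | hq
  · have hs : s.2 < 0 := by linarith
    constructor
    · refine lt_abs_exp_sub_rev hps ?_ ?_ le_rfl
      · exact (h1.wallHat_le hs.le).trans ((OnLax2.refl s).le_wallCheck hs.le)
      · have := profInv_sub_le (neg_le_neg hc1)
        simp only [wallCheck]
        linarith
    · refine lt_abs_exp_sub_rev hqq ?_ le_rfl ?_
      · have := profInv_strictMono.monotone (show q.2 ≤ -q.2 by linarith)
        simpa [wallHat, wallCheck] using this
      · have := profInv_strictMono.monotone hc2
        simp only [wallHat]
        linarith
  · have hs : 0 < s.2 := by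
      by_contra hs
      exact h0 0 ⟨not_lt.1 hs, hq⟩ rfl
    constructor
    -- Positive velocities are the ones for which a 2-rarefaction prolongs to the wall, so here the
    -- check-wall is constant.
    · have : wallCheck (s.1 - s.2 + c, c) = wallCheck q := by
        ext
        · simp only [wallCheck, profInv_of_nonpos (neg_nonpos.2 hq),
            profInv_of_nonpos (neg_nonpos.2 (hs.le.trans hc1))]
          linarith
        · rfl
      rwa [logJump, this]
    · refine lt_abs_exp_sub hsq ?_ le_rfl ?_
      · exact (h2.wallCheck_le (by linarith)).trans ((OnLax1.refl s).le_wallHat (by linarith))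
      · have := profInv_strictMono.monotone hc1
        simp only [wallHat]
        linarith

/-- The values of the profile are p, s, q and rarefaction states. A rarefaction through rest
contains states that close the valve; one avoiding rest inherits openness from its ends. -/
theorem unaffected_logLax_iff {K : ℝ} (hK : 0 < K) {p q s : ℝ × ℝ} (hs : middle p q = s)
    (h : K < logJump p q) :
    (∀ y, Unaffected K p (logLax p q y) ∧ Unaffected K (logLax p q y) q) ↔
      (Unaffected K p p ∧ Unaffected K q q ∧ Unaffected K p s ∧ Unaffected K s q) ∧
      (s.1 < p.1 → ∀ c ∈ Icc p.2 s.2, c ≠ 0) ∧ (s.1 < q.1 → ∀ c ∈ Icc s.2 q.2, c ≠ 0) := by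
  have h1 := hs ▸ onLax1_middle p q
  have h2 := hs ▸ onLax2_middle p q
  have hs0 : s.2 ≠ 0 := fun h0 => by
    rw [logJump_eq_zero (hs.symm ▸ h0)] at h; exact lt_asymm h hK
  have hx : ∀ x, logLax p q x = if x < s.2 then logWave1 p s x else logWave2 s q x :=
    fun x => by rw [← hs]; rfl
  constructor
  · intro H
    obtain ⟨x1, hx1, e1⟩ := exists_logWave1_eq_left p s s.2
    obtain ⟨x2, hx2, e2⟩ := exists_logWave2_eq_right h2 s.2
    have H1 := (H x1).1
    have H2 := (H x2).2
    have H3 := H s.2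
    rw [hx, if_pos hx1, e1] at H1
    rw [hx, if_neg hx2.not_gt, e2] at H2
    rw [hx, if_neg (lt_irrefl _), logWave2_of_le h2 le_rfl] at H3
    refine ⟨⟨H1, H2, H3⟩, ?_, ?_⟩
    · rintro hlt _ ⟨hp, hs1⟩ rfl
      -- Jump > K > 0 excludes s.2 = 0, so there are velocities just above 0 inside the rarefaction,
      -- even when the rest state is its end state p.
      obtain ⟨c, hj, hc⟩ := ((eventually_nhdsWithin_of_eventually_nhds
        (eventually_logJump_rarefaction1_lt hK hp)).and
        (Ioo_mem_nhdsGT (lt_of_le_of_ne hs1 hs0.symm))).exists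
      have hpc := hp.trans hc.1.le
      have := (H (c - 1)).1
      rw [hx, if_pos (by linarith [hc.2]), logWave1_eq_clamp h1 hlt.not_gt, sub_add_cancel,
        min_eq_left hc.2.le, max_eq_right hpc, Unaffected,
        middle_eq_right (OnLax1.rarefaction_left hpc)] at this
      exact lt_asymm hj (this hc.1.ne')
    · rintro hlt _ ⟨hs1, hq⟩ rfl
      obtain ⟨c, hj, hc⟩ := ((eventually_nhdsWithin_of_eventually_nhds
        (eventually_logJump_rarefaction2_lt hK hq)).and
        (Ioo_mem_nhdsLT (lt_of_le_of_ne hs1 hs0))).exists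
      have hcq := hc.2.le.trans hq
      have := (H (c + 1)).2
      rw [hx, if_neg (by linarith [hc.1]), logWave2_eq_clamp h2 hlt.not_gt, add_sub_cancel_right,
        min_eq_left hcq, max_eq_right hc.1.le, Unaffected,
        middle_eq_left (h2.rarefaction_right hlt.not_gt hcq)] at this
      have he := h2.eq_of_le hlt.not_gt
      rw [show q.1 - q.2 = s.1 - s.2 by linarith] at hj
      exact lt_asymm hj (this hc.2.ne)
  · rintro ⟨⟨Hpp, Hqq, Hps, Hsq⟩, H1, H2⟩ y
    have hps : K < logJump p s := Hps (by rwa [middle_eq_right h1])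
    have hsq : K < logJump s q := Hsq (by rwa [middle_eq_left h2])
    rw [hx]
    split_ifs
    · rcases logWave1_cases h1 y with e | e | ⟨hlt, hy, e⟩ <;> rw [e]
      · exact ⟨Hpp, unaffected_of_lt h⟩
      · exact ⟨Hps, Hsq⟩
      · have hpp : K < logJump p p := Hpp (by
          rw [middle_eq_right (OnLax1.refl p)]
          exact H1 hlt _ ⟨le_rfl, hy.1.trans hy.2⟩)
        have := lt_logJump_rarefaction1 h1 h2 hlt (H1 hlt) h hpp hps hsq hy
        exact ⟨unaffected_of_lt this.1, unaffected_of_lt this.2⟩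
    · rcases logWave2_cases h2 y with e | e | ⟨hlt, hy, e⟩ <;> rw [e]
      · exact ⟨Hps, Hsq⟩
      · exact ⟨unaffected_of_lt h, Hqq⟩
      · have hqq : K < logJump q q := Hqq (by
          rw [middle_eq_right (OnLax1.refl q)]
          exact H2 hlt _ ⟨hy.1.trans hy.2, le_rfl⟩)
        have := lt_logJump_rarefaction2 h1 h2 hlt (H2 hlt) h hqq hps hsq hy
        exact ⟨unaffected_of_lt this.1, unaffected_of_lt this.2⟩

/-! ### Transfer to the original variables -/

theorem closedJump_le_iff {a : ℝ} (ha : 0 < a) (M : ℝ) (p q : ℝ × ℝ) :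
    closedJump a (toState a p) (toState a q) ≤ M ↔ logJump p q ≤ M / a ^ 2 := by
  rw [closedJump_toState ha, le_div_iff₀' (by positivity)]

theorem RSv_toState {a : ℝ} (ha : 0 < a) (M : ℝ) (p q : ℝ × ℝ) (ξ : ℝ) :
    RSv a M (toState a p) (toState a q) ξ = toState a (logValve (M / a ^ 2) p q (ξ / a)) := by
  have hξ : ξ < 0 ↔ ξ / a < 0 := by rw [div_lt_iff₀ ha, zero_mul]
  simp only [RSv, closedJump_le_iff ha, logValve, hat_toState ha, check_toState ha,
    RSp_toState ha, logLax_eq_logWave1 (onLax1_wallHat p), logLax_eq_logWave2 (onLax2_wallCheck q),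
    apply_ite (toState a), hξ]

theorem forall_eq_toState_iff {a : ℝ} (ha : 0 < a) {f g : ℝ → ℝ × ℝ} :
    (∀ ξ, toState a (f (ξ / a)) = toState a (g (ξ / a))) ↔ ∀ x, f x = g x := by
  constructor
  · intro h x
    have := toState_injective ha (h (a * x))
    rwa [mul_div_cancel_left₀ _ ha.ne'] at this
  · intro h ξ
    rw [h]

theorem mem_domV_toState (a : ℝ) (p q : ℝ × ℝ) : (toState a p, toState a q) ∈ domV :=
  ⟨toState_mem a p, toState_mem a q⟩

theorem mem_setA_iff {a : ℝ} (ha : 0 < a) {M : ℝ} {p q : ℝ × ℝ} :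
    (toState a p, toState a q) ∈ setA a M ↔ logJump p q ≤ M / a ^ 2 := by
  simp only [setA, mem_ofPred_eq, mem_domV_toState, true_and, closedJump_le_iff ha]

theorem mem_setO_iff {a : ℝ} (ha : 0 < a) {M : ℝ} {p q : ℝ × ℝ} :
    (toState a p, toState a q) ∈ setO a M ↔ M / a ^ 2 < logJump p q := by
  simp only [setO, mem_ofPred_eq, mem_domV_toState, true_and, ← not_le, closedJump_le_iff ha]

theorem mem_setAN_iff {a : ℝ} (ha : 0 < a) {M : ℝ} {p q : ℝ × ℝ} :
    (toState a p, toState a q) ∈ setAN a M ↔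
      logJump p q ≤ M / a ^ 2 ∧ Unaffected (M / a ^ 2) p q := by
  simp only [setAN, mem_ofPred_eq, mem_setA_iff ha, RSv_toState ha, RSp_toState ha,
    forall_eq_toState_iff ha, unaffected_iff]

theorem mem_setAI_iff {a : ℝ} (ha : 0 < a) {M : ℝ} {p q : ℝ × ℝ} :
    (toState a p, toState a q) ∈ setAI a M ↔ ¬ Unaffected (M / a ^ 2) p q := by
  simp only [setAI, Set.mem_sdiff, mem_setA_iff ha, mem_setAN_iff ha, not_and]
  refine ⟨fun h => h.2 h.1, fun h => ⟨?_, fun _ => h⟩⟩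
  by_contra h'
  exact h (unaffected_of_lt (not_le.1 h'))

/-- An open valve and a closed one without influence are both covered by the single condition
`Unaffected`. -/
theorem mem_setAIc_iff {a : ℝ} (ha : 0 < a) {M : ℝ} {p q : ℝ × ℝ} :
    (toState a p, toState a q) ∈ setAIc a M ↔ Unaffected (M / a ^ 2) p q := by
  simp only [setAIc, Set.mem_sdiff, mem_domV_toState, true_and, mem_setAI_iff ha, not_not]

theorem setEq_of_toState {a : ℝ} (ha : 0 < a) {S T : Set (State × State)} (hS : S ⊆ domV)
    (hT : T ⊆ domV)
    (h : ∀ p q, (toState a p, toState a q) ∈ S ↔ (toState a p, toState a q) ∈ T) : S = T := by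
  have key : ∀ d ∈ domV, ∃ p q, d = (toState a p, toState a q) := fun d hd => by
    obtain ⟨p, hp⟩ := exists_toState ha hd.1
    obtain ⟨q, hq⟩ := exists_toState ha hd.2
    exact ⟨p, q, Prod.ext hp hq⟩
  ext d
  constructor
  · intro hd
    obtain ⟨p, q, rfl⟩ := key d (hS hd)
    exact (h p q).1 hd
  · intro hd
    obtain ⟨p, q, rfl⟩ := key d (hT hd)
    exact (h p q).2 hd

theorem tendsto_div_nhdsLT {a : ℝ} (ha : 0 < a) :
    Tendsto (fun ξ : ℝ => ξ / a) (𝓝[<] 0) (𝓝[<] 0) := by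
  refine tendsto_nhdsWithin_iff.2 ⟨?_, ?_⟩
  · have : Tendsto (fun ξ : ℝ => ξ / a) (𝓝 0) (𝓝 (0 / a)) := (continuous_id.div_const a).tendsto 0
    rw [zero_div] at this
    exact this.mono_left nhdsWithin_le_nhds
  · filter_upwards [self_mem_nhdsWithin] with x hx using div_neg_of_neg_of_pos hx ha

theorem tendsto_div_nhdsGT {a : ℝ} (ha : 0 < a) :
    Tendsto (fun ξ : ℝ => ξ / a) (𝓝[>] 0) (𝓝[>] 0) := by
  refine tendsto_nhdsWithin_iff.2 ⟨?_, ?_⟩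
  · have : Tendsto (fun ξ : ℝ => ξ / a) (𝓝 0) (𝓝 (0 / a)) := (continuous_id.div_const a).tendsto 0
    rw [zero_div] at this
    exact this.mono_left nhdsWithin_le_nhds
  · filter_upwards [self_mem_nhdsWithin] with x hx using div_pos hx ha

theorem leftLim_toState {a : ℝ} (ha : 0 < a) {f : ℝ → ℝ × ℝ} {l : ℝ × ℝ}
    (h : Tendsto f (𝓝[<] 0) (𝓝 l)) :
    Function.leftLim (fun ξ => toState a (f (ξ / a))) 0 = toState a l :=
  leftLim_eq_of_tendsto
    (((toState_continuous a).tendsto l).comp (h.comp (tendsto_div_nhdsLT ha)))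

theorem rightLim_toState {a : ℝ} (ha : 0 < a) {f : ℝ → ℝ × ℝ} {r : ℝ × ℝ}
    (h : Tendsto f (𝓝[>] 0) (𝓝 r)) :
    Function.rightLim (fun ξ => toState a (f (ξ / a))) 0 = toState a r :=
  rightLim_eq_of_tendsto
    (((toState_continuous a).tendsto r).comp (h.comp (tendsto_div_nhdsGT ha)))

theorem logValve_traces (K : ℝ) (p q : ℝ × ℝ) :
    ∃ l r, Tendsto (logValve K p q) (𝓝[<] 0) (𝓝 l) ∧ Tendsto (logValve K p q) (𝓝[>] 0) (𝓝 r) := by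
  rcases le_or_gt (logJump p q) K with h | h
  · exact ⟨_, _, logValve_tendsto_left h, logValve_tendsto_right h⟩
  · obtain ⟨l, r, hl, hr, -⟩ := logLax_traces p q
    rw [logValve_of_lt h]
    exact ⟨l, r, hl, hr⟩

/-! ### Coherence -/

theorem coherenceDomain_RSv {a M : ℝ} (ha : 0 < a) (hM : 0 < M) :
    coherenceDomain domV (RSv a M) = setA a M ∪ setOO a M := by
  refine setEq_of_toState ha (fun d hd => hd.1)
    (union_subset (fun d hd => hd.1) (fun d hd => hd.1.1)) fun p q => ?_
  obtain ⟨l, r, hl, hr⟩ := logValve_traces (M / a ^ 2) p q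
  have el := leftLim_toState ha hl
  have er := rightLim_toState ha hr
  have e : RSv a M (toState a p) (toState a q) =
      fun ξ => toState a (logValve (M / a ^ 2) p q (ξ / a)) := funext (RSv_toState ha M p q)
  have key : (toState a p, toState a q) ∈ coherenceDomain domV (RSv a M) ↔
      ∀ x, logValve (M / a ^ 2) l r x = if x < 0 then l else r := by
    simp only [coherenceDomain, mem_ofPred_eq, mem_domV_toState, true_and, e, el, er,
      RSv_toState ha]
    refine Iff.trans ?_ (forall_eq_toState_iff ha)
    simp only [apply_ite (toState a), div_lt_iff₀ ha, zero_mul]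
  rw [key, logValve_coherent_iff (by positivity) hl hr, mem_union, mem_setA_iff ha]
  refine or_congr Iff.rfl ?_
  simp only [setOO, mem_ofPred_eq, mem_setO_iff ha]
  refine and_congr_right fun h => ?_
  have e' : RSp a (toState a p) (toState a q) =
      fun ξ => toState a (logValve (M / a ^ 2) p q (ξ / a)) := by
    rw [logValve_of_lt h]; exact funext (RSp_toState ha p q)
  rw [e', el, er, mem_setO_iff ha]

/-! ### Consistency -/

theorem consistentAt_iff {a : ℝ} (ha : 0 < a) {M : ℝ} {p q : ℝ × ℝ} :
    (toState a p, toState a q) ∈ consistenceDomain domV (RSv a M) ↔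
      LogConsistent (M / a ^ 2) p q := by
  have hlt : ∀ ξ y : ℝ, ξ < a * y ↔ ξ / a < y := fun ξ y => (div_lt_iff₀' ha).symm
  simp only [consistenceDomain, ConsistentAt, mem_ofPred_eq, mem_domV_toState, true_and,
    RSv_toState ha]
  have hsurj : Function.Surjective fun y : ℝ => a * y := fun ξ =>
    ⟨ξ / a, mul_div_cancel₀ _ ha.ne'⟩
  rw [hsurj.forall]
  refine forall_congr' fun y => ?_
  simp only [mul_div_cancel_left₀ _ ha.ne', hlt, ← apply_ite (toState a)]
  rw [forall_eq_toState_iff ha (g := fun x => if x < y then _ else _),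
    forall_eq_toState_iff ha (g := fun x => if x < y then _ else _),
    forall_eq_toState_iff ha (g := fun x => if x < y then _ else _)]
  -- The gluing condition follows from the two cutting conditions.
  refine ⟨And.left, fun h => ⟨h, fun x => ?_⟩⟩
  rw [h.1 x, h.2 x]
  split_ifs <;> rfl

theorem consistenceDomain_RSv_eq_CN1_union_CN2 {a M : ℝ} (ha : 0 < a) :
    consistenceDomain domV (RSv a M) = setCN1 a M ∪ setCN2 a M := by
  refine setEq_of_toState ha (fun d hd => hd.1)
    (union_subset (fun d hd => hd.1.1.1) (fun d hd => hd.1.1)) fun p q => ?_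
  have hd : ∀ y, a * y / a = y := fun y => mul_div_cancel_left₀ y ha.ne'
  simp only [consistentAt_iff ha, mem_union, setCN1, setCN2, mem_ofPred_eq, mem_setAI_iff ha,
    mem_setAIc_iff ha, RSv_toState ha]
  by_cases h : Unaffected (M / a ^ 2) p q
  · simp only [h, not_true, false_and, false_or, true_and, logConsistent_iff_of_unaffected h]
    exact ⟨fun H ξ => H (ξ / a), fun H y => by simpa only [hd] using H (a * y)⟩
  · have hle : logJump p q ≤ M / a ^ 2 := not_lt.1 fun h' => h (unaffected_of_lt h')
    simp only [h, not_false_eq_true, false_and, or_false, true_and, logConsistent_iff_of_le hle]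
    constructor
    · rintro ⟨H1, H2⟩ ξ ξ' hξ hξ'
      have h1 : ξ / a < 0 := div_neg_of_neg_of_pos hξ ha
      have h2 : 0 ≤ ξ' / a := div_nonneg hξ' ha.le
      rw [logValve_of_le hle, logValve_of_le hle, if_pos h1, if_neg h2.not_gt]
      exact ⟨H1 _ h1, H2 _ h2⟩
    · intro H
      refine ⟨fun y hy => ?_, fun y hy => ?_⟩
      -- The unused ray is filled with an arbitrary admissible value, 0 here and -1 below.
      · have := (H (a * y) 0 (mul_neg_of_pos_of_neg ha hy) le_rfl).1
        rwa [hd, logValve_of_le hle, if_pos hy] at this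
      · have := (H (-1) (a * y) (by norm_num) (mul_nonneg ha.le hy)).2
        rwa [hd, logValve_of_le hle, if_neg hy.not_gt] at this

theorem nonzeroAlongRarefactions_iff {a : ℝ} (ha : 0 < a) {p q s : ℝ × ℝ} (hs : middle p q = s) :
    NonzeroAlongRarefactions a (toState a p) (toState a q) ↔
      (s.1 < p.1 → ∀ c ∈ Icc p.2 s.2, c ≠ 0) ∧ (s.1 < q.1 → ∀ c ∈ Icc s.2 q.2, c ≠ 0) := by
  have h1 := hs ▸ onLax1_middle p q
  have h2 := hs ▸ onLax2_middle p q
  have hx : ∀ x, logLax p q x = if x < s.2 then logWave1 p s x else logWave2 s q x :=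
    fun x => by rw [← hs]; rfl
  -- The rays are reparametrised by the velocity c of the rarefaction state they carry.
  have hs1 : Function.Surjective fun c : ℝ => a * (c - 1) := fun ξ =>
    ⟨ξ / a + 1, by field_simp; ring⟩
  have hs2 : Function.Surjective fun c : ℝ => a * (c + 1) := fun ξ =>
    ⟨ξ / a - 1, by field_simp; ring⟩
  have l1 : ∀ r : ℝ × ℝ, lam1 a (toState a r) = a * (r.2 - 1) := fun r => by
    rw [lam1, vel_toState]; ring
  have l2 : ∀ r : ℝ × ℝ, lam2 a (toState a r) = a * (r.2 + 1) := fun r => by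
    rw [lam2, vel_toState]; ring
  rw [NonzeroAlongRarefactions, tilde_toState ha, hs]
  simp only [show ∀ r, (toState a r).1 = Real.exp r.1 from fun _ => rfl, Real.exp_lt_exp]
  refine and_congr
    (imp_congr_right fun hlt => hs1.forall.trans (forall_congr' fun c => ?_))
    (imp_congr_right fun hlt => hs2.forall.trans (forall_congr' fun c => ?_))
  · simp only [l1, mem_Icc, mul_le_mul_iff_right₀ ha, RSp_toState_mul ha, ne_eq,
      toState_snd_eq_zero ha, sub_le_sub_iff_right]
    refine imp_congr_right fun hc => ?_
    rw [hx, if_pos (by linarith [hc.2]), logWave1_eq_clamp h1 hlt.not_gt, sub_add_cancel,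
      min_eq_left hc.2, max_eq_right hc.1]
  · simp only [l2, mem_Icc, mul_le_mul_iff_right₀ ha, RSp_toState_mul ha, ne_eq,
      toState_snd_eq_zero ha, add_le_add_iff_right]
    refine imp_congr_right fun hc => ?_
    rw [hx, if_neg (by linarith [hc.1]), logWave2_eq_clamp h2 hlt.not_gt, add_sub_cancel_right,
      min_eq_left hc.2, max_eq_right hc.1]

theorem consistenceDomain_RSv_eq_CNO_union_CNA {a M : ℝ} (ha : 0 < a) (hM : 0 < M) :
    consistenceDomain domV (RSv a M) = setCNO a M ∪ setCNA a M := by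
  refine setEq_of_toState ha (fun d hd => hd.1)
    (union_subset (fun d hd => hd.1.1) (fun d hd => hd.1.1)) fun p q => ?_
  have hK : 0 < M / a ^ 2 := by positivity
  simp only [consistentAt_iff ha, mem_union, setCNO, setCNA, mem_ofPred_eq, mem_setA_iff ha,
    mem_setO_iff ha, mem_setAIc_iff ha, tilde_toState ha, nonzeroAlongRarefactions_iff ha rfl]
  rcases le_or_gt (logJump p q) (M / a ^ 2) with h | h
  · have hp : 0 ≤ (toState a p).2 ↔ 0 ≤ p.2 := by
      rw [toState, mul_nonneg_iff_of_pos_left (Real.exp_pos _), mul_nonneg_iff_of_pos_left ha]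
    have hq : (toState a q).2 ≤ 0 ↔ q.2 ≤ 0 := by
      rw [toState, ← not_lt, mul_pos_iff_of_pos_left (Real.exp_pos _), mul_pos_iff_of_pos_left ha,
        not_lt]
    simp only [h, h.not_gt, false_and, false_or, true_and, logConsistent_iff_of_le h,
      unaffected_logWave1_wallHat_iff hK, unaffected_logWave2_wallCheck_iff hK, hp, hq]
    tauto
  · simp only [h, h.not_ge, false_and, or_false, true_and,
      logConsistent_iff_of_unaffected (unaffected_of_lt h), logValve_of_lt h]
    exact unaffected_logLax_iff hK rfl h

/-! ### Invariant domains -/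

/-- The coordinates of the states of `invRegion`. -/
def logRegion (r : ℝ) : Set (ℝ × ℝ) := {p | p.1 + p.2 ≤ r ∧ p.1 - p.2 ≤ r}

theorem logWave1_mem_logRegion {r : ℝ} {p s : ℝ × ℝ} (h : OnLax1 p s) (hp : p ∈ logRegion r)
    (hs : s ∈ logRegion r) (x : ℝ) : logWave1 p s x ∈ logRegion r := by
  rcases logWave1_cases h x with e | e | ⟨-, hx, e⟩ <;> rw [e]
  · exact hp
  · exact hs
  · exact ⟨by simpa using hp.1, by have := hp.2; simp only; linarith [hx.1]⟩

theorem logWave2_mem_logRegion {r : ℝ} {s q : ℝ × ℝ} (h : OnLax2 s q) (hs : s ∈ logRegion r)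
    (hq : q ∈ logRegion r) (x : ℝ) : logWave2 s q x ∈ logRegion r := by
  rcases logWave2_cases h x with e | e | ⟨hlt, hx, e⟩ <;> rw [e]
  · exact hs
  · exact hq
  · have := h.eq_of_le hlt.not_gt
    exact ⟨by have := hq.1; simp only; linarith [hx.2], by have := hs.2; simp only; linarith⟩

/-- Since `prof` is at least the identity, w cannot increase along the forward 1-curve nor z
decrease along the backward 2-curve; the middle state lies on both. -/
theorem logLax_mem_logRegion {r : ℝ} {p q : ℝ × ℝ} (hp : p ∈ logRegion r) (hq : q ∈ logRegion r)
    (x : ℝ) : logLax p q x ∈ logRegion r := by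
  have h1 := onLax1_middle p q
  have h2 := onLax2_middle p q
  have hs : middle p q ∈ logRegion r := by
    have e1 := le_prof ((middle p q).1 - p.1)
    have e2 := le_prof ((middle p q).1 - q.1)
    have := hp.1
    have := hq.2
    constructor
    · rw [h1]; linarith
    · rw [h2]; linarith
  rw [logLax]
  split_ifs
  · exact logWave1_mem_logRegion h1 hp hs x
  · exact logWave2_mem_logRegion h2 hs hq x

theorem logValve_mem_logRegion {K r : ℝ} {p q : ℝ × ℝ} (hp : p ∈ logRegion r)
    (hq : q ∈ logRegion r) (x : ℝ) : logValve K p q x ∈ logRegion r := by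
  rcases le_or_gt (logJump p q) K with h | h
  · rw [logValve_of_le h]
    split_ifs
    · refine logWave1_mem_logRegion (onLax1_wallHat p) hp ?_ x
      have := profInv_le p.2
      have := hp.1
      constructor <;> simp only [wallHat] <;> linarith
    · refine logWave2_mem_logRegion (onLax2_wallCheck q) ?_ hq x
      have := profInv_le (-q.2)
      have := hq.2
      constructor <;> simp only [wallCheck] <;> linarith
  · rw [logValve_of_lt h]
    exact logLax_mem_logRegion hp hq x

theorem toState_mem_invRegion_iff {a : ℝ} (ha : 0 < a) {u₀ : State} (h₀ : u₀.2 = 0)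
    {p : ℝ × ℝ} : toState a p ∈ invRegion a u₀ ↔ p ∈ logRegion (Real.log u₀.1) := by
  have hv : (toState a p).2 / (a * (toState a p).1) = p.2 :=
    congrArg Prod.snd (toLog_toState ha p)
  have hl : Real.log (toState a p).1 = p.1 := Real.log_exp _
  simp only [invRegion, mem_ofPred_eq, toState_mem, true_and, invZ, invW, hv, hl, h₀, zero_div,
    logRegion]
  constructor <;> rintro ⟨h1, h2⟩ <;> constructor <;> linarith

theorem isInvariantDomain_invRegion {a M : ℝ} (ha : 0 < a) {u₀ : State} (h₀ : u₀.2 = 0) :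
    IsInvariantDomain domV (RSv a M) (invRegion a u₀) := by
  refine ⟨fun u hu => hu.1, fun d hd => ⟨hd.1.1, hd.2.1⟩, fun ul hl ur hr ξ => ?_⟩
  obtain ⟨p, rfl⟩ := exists_toState ha hl.1
  obtain ⟨q, rfl⟩ := exists_toState ha hr.1
  rw [toState_mem_invRegion_iff ha h₀] at hl hr
  rw [RSv_toState ha, toState_mem_invRegion_iff ha h₀]
  exact logValve_mem_logRegion hl hr _

/-! ### Continuous dependence on the data -/

/-- The middle log-density is the zero of a strictly increasing function depending continuously on
the data, so signs at fixed t trap it. -/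
theorem tendsto_middle {ι : Type*} {l : Filter ι} {P Q : ι → ℝ × ℝ} {p q : ℝ × ℝ}
    (hP : Tendsto P l (𝓝 p)) (hQ : Tendsto Q l (𝓝 q)) :
    Tendsto (fun i => middle (P i) (Q i)) l (𝓝 (middle p q)) := by
  let F : ℝ × ℝ → ℝ × ℝ → ℝ → ℝ := fun p q t => prof (t - p.1) + prof (t - q.1) - (p.2 - q.2)
  have hmono : ∀ p q, StrictMono (F p q) := fun p q s t h =>
    sub_lt_sub_right
      (add_lt_add (prof_strictMono (by linarith)) (prof_strictMono (by linarith))) _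
  have hzero : ∀ p q, F p q (middle p q).1 = 0 := fun p q => by
    have h1 := onLax1_middle p q
    have h2 := onLax2_middle p q
    unfold OnLax1 at h1
    unfold OnLax2 at h2
    simp only [F]
    linarith
  have hprof : ∀ {f : ι → ℝ} {x : ℝ}, Tendsto f l (𝓝 x) →
      Tendsto (fun i => prof (f i)) l (𝓝 (prof x)) := fun h => (prof_continuous.tendsto _).comp h
  have hP1 := hP.fst_nhds
  have hP2 := hP.snd_nhds
  have hQ1 := hQ.fst_nhds
  have hQ2 := hQ.snd_nhds
  have hF : ∀ t, Tendsto (fun i => F (P i) (Q i) t) l (𝓝 (F p q t)) := fun t =>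
    ((hprof (hP1.const_sub t)).add (hprof (hQ1.const_sub t))).sub (hP2.sub hQ2)
  have h1 : Tendsto (fun i => (middle (P i) (Q i)).1) l (𝓝 (middle p q).1) := by
    refine tendsto_order.2 ⟨fun t ht => ?_, fun t ht => ?_⟩
    · have : F p q t < 0 := by rw [← hzero p q]; exact hmono p q ht
      filter_upwards [(hF t).eventually_lt_const this] with i hi
      rw [← hzero (P i) (Q i)] at hi
      exact (hmono _ _).lt_iff_lt.1 hi
    · have : 0 < F p q t := by rw [← hzero p q]; exact hmono p q ht
      filter_upwards [(hF t).eventually_const_lt this] with i hi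
      rw [← hzero (P i) (Q i)] at hi
      exact (hmono _ _).lt_iff_lt.1 hi
  have h2 : Tendsto (fun i => (middle (P i) (Q i)).2) l (𝓝 (middle p q).2) := by
    rw [onLax1_middle p q, funext fun i => onLax1_middle (P i) (Q i)]
    exact hP2.sub (hprof (h1.sub hP1))
  exact h1.prodMk_nhds h2

theorem wallHat_continuous : Continuous wallHat := by
  have := profInv_continuous
  unfold wallHat; fun_prop

theorem wallCheck_continuous : Continuous wallCheck := by
  have := profInv_continuous
  unfold wallCheck; fun_prop

theorem tendsto_logJump {ι : Type*} {l : Filter ι} {P Q : ι → ℝ × ℝ} {p q : ℝ × ℝ}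
    (hP : Tendsto P l (𝓝 p)) (hQ : Tendsto Q l (𝓝 q)) :
    Tendsto (fun i => logJump (P i) (Q i)) l (𝓝 (logJump p q)) := by
  have h1 := ((wallHat_continuous.tendsto p).comp hP).fst_nhds
  have h2 := ((wallCheck_continuous.tendsto q).comp hQ).fst_nhds
  exact (((Real.continuous_exp.tendsto _).comp h2).sub
    ((Real.continuous_exp.tendsto _).comp h1)).abs

/-- Convergence of measurable profiles, bounded and off a countable set. -/
structure ProfileTendsto {ι : Type*} (l : Filter ι) (f : ι → ℝ → ℝ × ℝ) (g : ℝ → ℝ × ℝ) :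
    Prop where
  measurable : ∀ i, Measurable (f i)
  measurable_limit : Measurable g
  bounded : ∃ C, (∀ x, ‖g x‖ ≤ C) ∧ ∀ᶠ i in l, ∀ x, ‖f i x‖ ≤ C
  tendsto : ∃ T : Set ℝ, T.Countable ∧ ∀ x ∉ T, Tendsto (fun i => f i x) l (𝓝 (g x))

/-- Away from the limit junction c₀ the active branch is eventually fixed, so only one exceptional
point is added. -/
theorem ProfileTendsto.ite {ι : Type*} {l : Filter ι} {f f' : ι → ℝ → ℝ × ℝ} {g g' : ℝ → ℝ × ℝ}
    {c : ι → ℝ} {c₀ : ℝ} (h : ProfileTendsto l f g) (h' : ProfileTendsto l f' g')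
    (hc : Tendsto c l (𝓝 c₀)) :
    ProfileTendsto l (fun i x => if x < c i then f i x else f' i x)
      (fun x => if x < c₀ then g x else g' x) where
  measurable i := Measurable.ite measurableSet_Iio (h.measurable i) (h'.measurable i)
  measurable_limit := Measurable.ite measurableSet_Iio h.measurable_limit h'.measurable_limit
  bounded := by
    obtain ⟨C, hg, hf⟩ := h.bounded
    obtain ⟨C', hg', hf'⟩ := h'.bounded
    refine ⟨max C C', fun x => ?_, ?_⟩
    · split_ifs
      · exact (hg x).trans (le_max_left _ _)
      · exact (hg' x).trans (le_max_right _ _)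
    · filter_upwards [hf, hf'] with i hi hi' x
      split_ifs
      · exact (hi x).trans (le_max_left _ _)
      · exact (hi' x).trans (le_max_right _ _)
  tendsto := by
    obtain ⟨T, hT, ht⟩ := h.tendsto
    obtain ⟨T', hT', ht'⟩ := h'.tendsto
    refine ⟨T ∪ T' ∪ {c₀}, (hT.union hT').union (countable_singleton _), fun x hx => ?_⟩
    simp only [mem_union, mem_singleton_iff, not_or] at hx
    rcases lt_or_gt_of_ne hx.2 with hlt | hlt
    · rw [if_pos hlt]
      refine (ht x hx.1.1).congr' ?_
      filter_upwards [hc.eventually_const_lt hlt] with i hi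
      rw [if_pos hi]
    · rw [if_neg hlt.not_gt]
      refine (ht' x hx.1.2).congr' ?_
      filter_upwards [hc.eventually_lt_const hlt] with i hi
      rw [if_neg hi.not_gt]

theorem ProfileTendsto.congr' {ι : Type*} {l : Filter ι} {f f' : ι → ℝ → ℝ × ℝ} {g : ℝ → ℝ × ℝ}
    (h : ProfileTendsto l f g) (hf' : ∀ i, Measurable (f' i)) (he : ∀ᶠ i in l, f i = f' i) :
    ProfileTendsto l f' g where
  measurable := hf'
  measurable_limit := h.measurable_limit
  bounded := by
    obtain ⟨C, hg, hf⟩ := h.bounded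
    refine ⟨C, hg, ?_⟩
    filter_upwards [hf, he] with i hi hei
    rwa [← hei]
  tendsto := by
    obtain ⟨T, hT, ht⟩ := h.tendsto
    refine ⟨T, hT, fun x hx => (ht x hx).congr' ?_⟩
    filter_upwards [he] with i hi
    rw [hi]

theorem measurable_logWave1 (p s : ℝ × ℝ) : Measurable (logWave1 p s) := by
  unfold logWave1
  split_ifs
  · exact Measurable.ite measurableSet_Iio measurable_const measurable_const
  · exact Measurable.ite measurableSet_Iio measurable_const
      (Measurable.ite measurableSet_Iio (by fun_prop) measurable_const)

theorem measurable_logWave2 (s q : ℝ × ℝ) : Measurable (logWave2 s q) := by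
  unfold logWave2
  split_ifs
  · exact Measurable.ite measurableSet_Iio measurable_const measurable_const
  · exact Measurable.ite measurableSet_Iio measurable_const
      (Measurable.ite measurableSet_Iio (by fun_prop) measurable_const)

theorem measurable_logLax (p q : ℝ × ℝ) : Measurable (logLax p q) :=
  Measurable.ite measurableSet_Iio (measurable_logWave1 _ _) (measurable_logWave2 _ _)

theorem measurable_logValve (K : ℝ) (p q : ℝ × ℝ) : Measurable (logValve K p q) := by
  unfold logValve
  split_ifs
  · exact Measurable.ite measurableSet_Iio (measurable_logWave1 _ _) (measurable_logWave2 _ _)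
  · exact measurable_logLax p q

/-- This bounds the profiles uniformly and handles waves of vanishing strength, whose type may
alternate between shock and rarefaction. -/
theorem dist_logWave1_le {p s : ℝ × ℝ} (h : OnLax1 p s) (x : ℝ) :
    dist (logWave1 p s x) p ≤ dist s p := by
  rcases logWave1_cases h x with e | e | ⟨hlt, hx, e⟩ <;> rw [e]
  · simp
  · have he := h.eq_of_le hlt.not_gt
    obtain ⟨hx1, hx2⟩ := hx
    rw [Prod.dist_eq, Prod.dist_eq]
    simp only [Real.dist_eq]
    refine max_le_max ?_ ?_
    · rw [abs_of_nonpos (by linarith), abs_of_nonpos (by linarith)]; linarith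
    · rw [abs_of_nonneg (by linarith), abs_of_nonneg (by linarith)]; linarith

theorem dist_logWave2_le {s q : ℝ × ℝ} (h : OnLax2 s q) (x : ℝ) :
    dist (logWave2 s q x) s ≤ dist q s := by
  rcases logWave2_cases h x with e | e | ⟨hlt, hx, e⟩ <;> rw [e]
  · simp
  · have he := h.eq_of_le hlt.not_gt
    obtain ⟨hx1, hx2⟩ := hx
    rw [Prod.dist_eq, Prod.dist_eq]
    simp only [Real.dist_eq]
    refine max_le_max ?_ ?_
    · rw [abs_of_nonneg (by linarith), abs_of_nonneg (by linarith)]; linarith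
    · rw [abs_of_nonneg (by linarith), abs_of_nonneg (by linarith)]; linarith

/-- Profiles that stay as close to `P i` as `S i` does are eventually uniformly bounded. -/
theorem bounded_of_dist_le {ι : Type*} {l : Filter ι} {P S : ι → ℝ × ℝ} {p s : ℝ × ℝ}
    (hP : Tendsto P l (𝓝 p)) (hS : Tendsto S l (𝓝 s)) {f : ι → ℝ → ℝ × ℝ} {g : ℝ → ℝ × ℝ}
    (hf : ∀ i x, dist (f i x) (P i) ≤ dist (S i) (P i)) (hg : ∀ x, dist (g x) p ≤ dist s p) :
    ∃ C, (∀ x, ‖g x‖ ≤ C) ∧ ∀ᶠ i in l, ∀ x, ‖f i x‖ ≤ C := by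
  have key : ∀ {u v w : ℝ × ℝ}, dist u v ≤ dist w v → ‖u‖ ≤ dist w v + ‖v‖ := fun {u v w} h => by
    rw [← dist_zero_right u, ← dist_zero_right v]
    exact (dist_triangle _ v _).trans (by gcongr)
  refine ⟨dist s p + ‖p‖ + 1, fun x => (key (hg x)).trans (by linarith), ?_⟩
  filter_upwards [((hS.dist hP).add hP.norm).eventually_lt_const (lt_add_one _)] with i hi x
  exact (key (hf i x)).trans hi.le

theorem tendsto_of_dist_le {ι : Type*} {l : Filter ι} {P S f : ι → ℝ × ℝ} {p : ℝ × ℝ}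
    (hP : Tendsto P l (𝓝 p)) (hS : Tendsto S l (𝓝 p))
    (hf : ∀ i, dist (f i) (P i) ≤ dist (S i) (P i)) : Tendsto f l (𝓝 p) := by
  rw [tendsto_iff_dist_tendsto_zero]
  have h0 : Tendsto (fun i => dist (S i) (P i) + dist (P i) p) l (𝓝 0) := by
    simpa using (hS.dist hP).add (hP.dist (tendsto_const_nhds (x := p)))
  exact squeeze_zero (fun _ => dist_nonneg)
    (fun i => (dist_triangle _ (P i) _).trans (add_le_add_left (hf i) _)) h0

theorem profileTendsto_logWave1 {ι : Type*} {l : Filter ι} {P S : ι → ℝ × ℝ} {p s : ℝ × ℝ}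
    (hP : Tendsto P l (𝓝 p)) (hS : Tendsto S l (𝓝 s)) (hPS : ∀ i, OnLax1 (P i) (S i))
    (hps : OnLax1 p s) :
    ProfileTendsto l (fun i => logWave1 (P i) (S i)) (logWave1 p s) where
  measurable i := measurable_logWave1 _ _
  measurable_limit := measurable_logWave1 _ _
  bounded := bounded_of_dist_le hP hS (fun i => dist_logWave1_le (hPS i)) (dist_logWave1_le hps)
  tendsto := by
    have hP1 := hP.fst_nhds
    have hP2 := hP.snd_nhds
    have hS1 := hS.fst_nhds
    have hS2 := hS.snd_nhds
    refine ⟨{p.2 - Real.exp ((s.1 - p.1) / 2)}, countable_singleton _, fun x hx => ?_⟩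
    rcases lt_trichotomy p.1 s.1 with h | h | h
    · have hc : Tendsto (fun i => (P i).2 - Real.exp (((S i).1 - (P i).1) / 2)) l
          (𝓝 (p.2 - Real.exp ((s.1 - p.1) / 2))) :=
        hP2.sub ((Real.continuous_exp.tendsto _).comp ((hS1.sub hP1).div_const 2))
      rw [logWave1, if_pos h]
      rcases lt_or_gt_of_ne (show x ≠ _ from hx) with hlt | hlt
      · rw [if_pos hlt]
        refine hP.congr' ?_
        filter_upwards [hP1.eventually_lt hS1 h, hc.eventually_const_lt hlt] with i h1 h2
        rw [logWave1, if_pos h1, if_pos h2]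
      · rw [if_neg hlt.not_gt]
        refine hS.congr' ?_
        filter_upwards [hP1.eventually_lt hS1 h, hc.eventually_lt_const hlt] with i h1 h2
        rw [logWave1, if_pos h1, if_neg h2.not_gt]
    -- The limit wave is null: both ends tend to p and squeeze the profile, whatever the type of the
    -- approximating waves.
    · obtain rfl := hps.eq_of_fst_eq h
      rw [logWave1_self]
      exact tendsto_of_dist_le hP hS fun i => dist_logWave1_le (hPS i) x
    · rw [logWave1_eq_clamp hps h.not_gt]
      have hm := hP2.max ((tendsto_const_nhds (x := x + 1)).min hS2)
      refine (((hP1.add hP2).sub hm).prodMk_nhds hm).congr' ?_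
      filter_upwards [hS1.eventually_lt hP1 h] with i hi
      rw [logWave1_eq_clamp (hPS i) hi.not_gt]

theorem profileTendsto_logWave2 {ι : Type*} {l : Filter ι} {S Q : ι → ℝ × ℝ} {s q : ℝ × ℝ}
    (hS : Tendsto S l (𝓝 s)) (hQ : Tendsto Q l (𝓝 q)) (hSQ : ∀ i, OnLax2 (S i) (Q i))
    (hsq : OnLax2 s q) :
    ProfileTendsto l (fun i => logWave2 (S i) (Q i)) (logWave2 s q) where
  measurable i := measurable_logWave2 _ _
  measurable_limit := measurable_logWave2 _ _
  bounded := bounded_of_dist_le hS hQ (fun i => dist_logWave2_le (hSQ i)) (dist_logWave2_le hsq)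
  tendsto := by
    have hQ1 := hQ.fst_nhds
    have hQ2 := hQ.snd_nhds
    have hS1 := hS.fst_nhds
    have hS2 := hS.snd_nhds
    refine ⟨{q.2 + Real.exp ((s.1 - q.1) / 2)}, countable_singleton _, fun x hx => ?_⟩
    rcases lt_trichotomy q.1 s.1 with h | h | h
    · have hc : Tendsto (fun i => (Q i).2 + Real.exp (((S i).1 - (Q i).1) / 2)) l
          (𝓝 (q.2 + Real.exp ((s.1 - q.1) / 2))) :=
        hQ2.add ((Real.continuous_exp.tendsto _).comp ((hS1.sub hQ1).div_const 2))
      rw [logWave2, if_pos h]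
      rcases lt_or_gt_of_ne (show x ≠ _ from hx) with hlt | hlt
      · rw [if_pos hlt]
        refine hS.congr' ?_
        filter_upwards [hQ1.eventually_lt hS1 h, hc.eventually_const_lt hlt] with i h1 h2
        rw [logWave2, if_pos h1, if_pos h2]
      · rw [if_neg hlt.not_gt]
        refine hQ.congr' ?_
        filter_upwards [hQ1.eventually_lt hS1 h, hc.eventually_lt_const hlt] with i h1 h2
        rw [logWave2, if_pos h1, if_neg h2.not_gt]
    · obtain rfl := hsq.eq_of_fst_eq h
      rw [logWave2_self]
      exact tendsto_of_dist_le hS hQ fun i => dist_logWave2_le (hSQ i) x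
    · rw [logWave2_eq_clamp hsq h.not_gt]
      have hm := hS2.max ((tendsto_const_nhds (x := x - 1)).min hQ2)
      refine (((hS1.sub hS2).add hm).prodMk_nhds hm).congr' ?_
      filter_upwards [hS1.eventually_lt hQ1 h] with i hi
      rw [logWave2_eq_clamp (hSQ i) hi.not_gt]

theorem profileTendsto_logLax {ι : Type*} {l : Filter ι} {P Q : ι → ℝ × ℝ} {p q : ℝ × ℝ}
    (hP : Tendsto P l (𝓝 p)) (hQ : Tendsto Q l (𝓝 q)) :
    ProfileTendsto l (fun i => logLax (P i) (Q i)) (logLax p q) :=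
  have hm := tendsto_middle hP hQ
  (profileTendsto_logWave1 hP hm (fun _ => onLax1_middle _ _) (onLax1_middle p q)).ite
    (profileTendsto_logWave2 hm hQ (fun _ => onLax2_middle _ _) (onLax2_middle p q)) hm.snd_nhds

theorem profileTendsto_logValve {ι : Type*} {l : Filter ι} {P Q : ι → ℝ × ℝ} {p q : ℝ × ℝ}
    {K : ℝ} (hP : Tendsto P l (𝓝 p)) (hQ : Tendsto Q l (𝓝 q)) (hK : logJump p q ≠ K) :
    ProfileTendsto l (fun i => logValve K (P i) (Q i)) (logValve K p q) := by
  rcases lt_or_gt_of_ne hK with h | h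
  · rw [funext (logValve_of_le h.le)]
    refine ProfileTendsto.congr' ((profileTendsto_logWave1 hP ((wallHat_continuous.tendsto p).comp hP)
      (fun _ => onLax1_wallHat _) (onLax1_wallHat p)).ite (profileTendsto_logWave2
      ((wallCheck_continuous.tendsto q).comp hQ) hQ (fun _ => onLax2_wallCheck _)
      (onLax2_wallCheck q)) (c := fun _ => 0) tendsto_const_nhds)
      (fun i => measurable_logValve _ _ _) ?_
    filter_upwards [(tendsto_logJump hP hQ).eventually_lt_const h] with i hi
    exact (funext (logValve_of_le hi.le)).symm
  · rw [logValve_of_lt h]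
    refine (profileTendsto_logLax hP hQ).congr' (fun i => measurable_logValve _ _ _) ?_
    filter_upwards [(tendsto_logJump hP hQ).eventually_const_lt h] with i hi
    exact (logValve_of_lt hi).symm

theorem measurable_toState_comp {a : ℝ} {f : ℝ → ℝ × ℝ} (hf : Measurable f) :
    Measurable fun ξ => toState a (f (ξ / a)) :=
  (toState_continuous a).measurable.comp (hf.comp (measurable_id.div_const a))

/-- `toState` is bounded on the closed ball containing the values, which gives a constant dominating
function on a bounded interval; the exceptional set is countable, hence null. -/
theorem ProfileTendsto.tendsto_lintegral {ι : Type*} {l : Filter ι} [l.IsCountablyGenerated]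
    {f : ι → ℝ → ℝ × ℝ} {g : ℝ → ℝ × ℝ} (h : ProfileTendsto l f g) {a : ℝ} (ha : 0 < a)
    (ξ₁ ξ₂ : ℝ) :
    Tendsto (fun i => ∫⁻ ξ in Icc ξ₁ ξ₂, ‖toState a (f i (ξ / a)) - toState a (g (ξ / a))‖ₑ) l
      (𝓝 0) := by
  obtain ⟨C, hg, hf⟩ := h.bounded
  obtain ⟨T, hT, ht⟩ := h.tendsto
  obtain ⟨B, hB⟩ := (isCompact_closedBall (0 : ℝ × ℝ) C).exists_bound_of_continuousOn
    (toState_continuous a).continuousOn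
  have hB' : ∀ v : ℝ × ℝ, ‖v‖ ≤ C → ‖toState a v‖ ≤ B := fun v hv =>
    hB v (by simpa using hv)
  have key := tendsto_lintegral_filter_of_dominated_convergence
    (μ := volume.restrict (Icc ξ₁ ξ₂)) (l := l)
    (F := fun i ξ => ‖toState a (f i (ξ / a)) - toState a (g (ξ / a))‖ₑ) (f := fun _ => 0)
    (fun _ => ENNReal.ofReal (B + B)) ?_ ?_ ?_ ?_
  · simpa using key
  · exact Eventually.of_forall fun i => ((measurable_toState_comp (h.measurable i)).sub
      (measurable_toState_comp h.measurable_limit)).enorm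
  · filter_upwards [hf] with i hi
    refine Eventually.of_forall fun ξ => ?_
    rw [← ofReal_norm]
    exact ENNReal.ofReal_le_ofReal ((norm_sub_le _ _).trans
      (add_le_add (hB' _ (hi _)) (hB' _ (hg _))))
  · simp [ENNReal.mul_eq_top]
  · have hinj : Function.Injective fun ξ : ℝ => ξ / a := fun x y hxy => by
      simpa [div_left_inj' ha.ne'] using hxy
    filter_upwards [(hT.preimage hinj).ae_notMem (volume.restrict (Icc ξ₁ ξ₂))] with ξ hξ
    have := (((toState_continuous a).tendsto _).comp (ht _ hξ)).sub_const (toState a (g (ξ / a)))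
    rw [sub_self] at this
    simpa using this.enorm

/-! ### Discontinuity at the threshold -/

theorem exists_mem_of_ae_restrict {P : ℝ → Prop}
    (h : ∀ᵐ ξ ∂volume.restrict (Icc (-1 : ℝ) 1), P ξ) {b c : ℝ} (hb : -1 ≤ b) (hc : c ≤ 1)
    (hbc : b < c) : ∃ ξ ∈ Ioo b c, P ξ := by
  have h' := ae_restrict_of_ae_restrict_of_subset
    (Ioo_subset_Icc_self.trans (Icc_subset_Icc hb hc) : Ioo b c ⊆ _) h
  rw [ae_restrict_iff' measurableSet_Ioo] at h'
  have hpos : volume (Ioo b c) ≠ 0 := by simpa using hbc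
  obtain ⟨ξ, h1, h2⟩ := ((frequently_ae_mem_iff.2 hpos).and_eventually h').exists
  exact ⟨ξ, h1, h2 h1⟩

/-- Equality almost everywhere holds at points accumulating at 0, which is enough to identify
one-sided limits. -/
theorem frequently_nhdsLT_of_ae {P : ℝ → Prop}
    (h : ∀ᵐ ξ ∂volume.restrict (Icc (-1 : ℝ) 1), P ξ) : ∃ᶠ ξ in 𝓝[<] (0 : ℝ), P ξ := by
  intro hn
  obtain ⟨b, hb, hsub⟩ := mem_nhdsLT_iff_exists_Ioo_subset.1 hn
  obtain ⟨ξ, hξ, hP⟩ := exists_mem_of_ae_restrict h (le_max_right b (-1)) zero_le_one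
    (max_lt hb (by norm_num))
  exact hsub ⟨(le_max_left _ _).trans_lt hξ.1, hξ.2⟩ hP

theorem frequently_nhdsGT_of_ae {P : ℝ → Prop}
    (h : ∀ᵐ ξ ∂volume.restrict (Icc (-1 : ℝ) 1), P ξ) : ∃ᶠ ξ in 𝓝[>] (0 : ℝ), P ξ := by
  intro hn
  obtain ⟨b, hb, hsub⟩ := mem_nhdsGT_iff_exists_Ioo_subset.1 hn
  obtain ⟨ξ, hξ, hP⟩ := exists_mem_of_ae_restrict h (by norm_num) (min_le_right b 1)
    (lt_min hb one_pos)
  exact hsub ⟨hξ.1, hξ.2.trans_le (min_le_left _ _)⟩ hP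

theorem mem_continuityDomain {a M : ℝ} (ha : 0 < a) {p q : ℝ × ℝ}
    (h : logJump p q ≠ M / a ^ 2) :
    (toState a p, toState a q) ∈ continuityDomain domV (RSv a M) := by
  refine ⟨mem_domV_toState a p q, fun ξ₁ ξ₂ => ?_⟩
  set d := (toState a p, toState a q) with hd
  have hP : Tendsto (fun e : State × State => toLog a e.1) (𝓝[domV] d) (𝓝 p) := by
    have := (toLog_continuousAt ha (toState_mem a p)).tendsto
    rw [toLog_toState ha] at this
    exact this.comp (continuousAt_fst.tendsto.mono_left nhdsWithin_le_nhds)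
  have hQ : Tendsto (fun e : State × State => toLog a e.2) (𝓝[domV] d) (𝓝 q) := by
    have := (toLog_continuousAt ha (toState_mem a q)).tendsto
    rw [toLog_toState ha] at this
    exact this.comp (continuousAt_snd.tendsto.mono_left nhdsWithin_le_nhds)
  refine ((profileTendsto_logValve hP hQ h).tendsto_lintegral ha ξ₁ ξ₂).congr' ?_
  filter_upwards [self_mem_nhdsWithin] with e he
  simp only [← RSv_toState ha, toState_toLog ha he.1, toState_toLog ha he.2, hd]

/-- Every datum can be approached by data with a larger jump. -/
theorem exists_tendsto_logJump_lt (p q : ℝ × ℝ) :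
    ∃ P : ℝ → ℝ × ℝ, Tendsto P (𝓝[>] 0) (𝓝 p) ∧
      ∀ ε > 0, logJump p q < logJump (P ε) q := by
  -- Changing the log-density at fixed velocity shifts the wall by the same amount; the sign of the
  -- shift moves it away from the other wall.
  have hw : ∀ ε, (wallHat (p.1 + ε, p.2)).1 = (wallHat p).1 + ε := fun ε => by
    simp only [wallHat]; ring
  have hc : ∀ σ : ℝ, Tendsto (fun ε : ℝ => (p.1 + σ * ε, p.2)) (𝓝[>] 0) (𝓝 p) := fun σ => by
    have : Continuous fun ε : ℝ => (p.1 + σ * ε, p.2) := by fun_prop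
    have := this.tendsto 0
    simp only [mul_zero, add_zero] at this
    exact this.mono_left nhdsWithin_le_nhds
  rcases le_or_gt (wallCheck q).1 (wallHat p).1 with hle | hlt
  · refine ⟨_, hc 1, fun ε hε => ?_⟩
    have h1 := Real.exp_le_exp.2 hle
    have h2 : Real.exp (wallHat p).1 < Real.exp ((wallHat p).1 + 1 * ε) :=
      Real.exp_lt_exp.2 (by linarith)
    rw [logJump, logJump, hw, abs_of_nonpos (by linarith), abs_of_nonpos (by linarith)]
    linarith
  · refine ⟨_, hc (-1), fun ε hε => ?_⟩
    have h1 := Real.exp_lt_exp.2 hlt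
    have h2 : Real.exp ((wallHat p).1 + -1 * ε) < Real.exp (wallHat p).1 :=
      Real.exp_lt_exp.2 (by linarith)
    rw [logJump, logJump, hw, abs_of_nonneg (by linarith), abs_of_nonneg (by linarith)]
    linarith

/-- Along data with larger jump the solutions are Lax solutions and converge to the Lax solution of
(p, q). Continuity would identify it with the closed one, although the jump is positive. -/
theorem notMem_continuityDomain {a M : ℝ} (ha : 0 < a) (hM : 0 < M) {p q : ℝ × ℝ}
    (h : logJump p q = M / a ^ 2) :
    (toState a p, toState a q) ∉ continuityDomain domV (RSv a M) := by
  rintro ⟨-, H⟩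
  have hK : 0 < logJump p q := by rw [h]; positivity
  obtain ⟨P, hP, hj⟩ := exists_tendsto_logJump_lt p q
  let L : ℝ → ℝ × ℝ → State := fun ξ r => toState a (logLax r q (ξ / a))
  let V : ℝ → State := fun ξ => toState a (logValve (M / a ^ 2) p q (ξ / a))
  have hLm : ∀ r, Measurable fun ξ => L ξ r := fun r =>
    measurable_toState_comp (measurable_logLax r q)
  have hVm : Measurable V := measurable_toState_comp (measurable_logValve _ p q)
  have t1 : Tendsto (fun ε => ∫⁻ ξ in Icc (-1) 1, ‖L ξ (P ε) - L ξ p‖ₑ) (𝓝[>] 0) (𝓝 0) :=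
    (profileTendsto_logLax hP tendsto_const_nhds).tendsto_lintegral ha (-1) 1
  have t2 : Tendsto (fun ε => ∫⁻ ξ in Icc (-1) 1, ‖L ξ (P ε) - V ξ‖ₑ) (𝓝[>] 0) (𝓝 0) := by
    have hd : Tendsto (fun ε => (toState a (P ε), toState a q)) (𝓝[>] 0)
        (𝓝[domV] (toState a p, toState a q)) :=
      tendsto_nhdsWithin_iff.2 ⟨(((toState_continuous a).tendsto p).comp hP).prodMk_nhds
        tendsto_const_nhds, Eventually.of_forall fun ε => mem_domV_toState a (P ε) q⟩
    refine ((H (-1) 1).comp hd).congr' ?_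
    filter_upwards [self_mem_nhdsWithin] with ε hε
    simp only [Function.comp_apply, RSv_toState ha, logValve_of_lt (h ▸ hj ε hε), L, V]
  -- Two L¹ limits of the same family coincide, by the triangle inequality.
  have h0 : ∫⁻ ξ in Icc (-1) 1, ‖L ξ p - V ξ‖ₑ = 0 := by
    have ht := t1.add t2
    rw [add_zero] at ht
    refine le_antisymm (ge_of_tendsto' ht fun ε => ?_) bot_le
    have hm : Measurable fun ξ => ‖L ξ (P ε) - L ξ p‖ₑ := ((hLm _).sub (hLm _)).enorm
    rw [← lintegral_add_left hm]
    refine lintegral_mono fun ξ => ?_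
    rw [← enorm_neg (L ξ (P ε) - L ξ p)]
    refine le_trans (le_of_eq ?_) (enorm_add_le _ _)
    congr 1
    abel
  have hm : Measurable fun ξ => ‖L ξ p - V ξ‖ₑ := ((hLm p).sub hVm).enorm
  rw [lintegral_eq_zero_iff hm] at h0
  have hae : ∀ᵐ ξ ∂volume.restrict (Icc (-1 : ℝ) 1),
      logLax p q (ξ / a) = logValve (M / a ^ 2) p q (ξ / a) := by
    filter_upwards [h0] with ξ hξ
    have : L ξ p - V ξ = 0 := by simpa using hξ
    exact toState_injective ha (sub_eq_zero.1 this)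
  obtain ⟨l, r, tl, tr, -, hmid⟩ := logLax_traces p q
  have el : l = wallHat p := tendsto_nhds_unique_of_frequently_eq (tl.comp (tendsto_div_nhdsLT ha))
    ((logValve_tendsto_left h.le).comp (tendsto_div_nhdsLT ha)) (frequently_nhdsLT_of_ae hae)
  have er : r = wallCheck q :=
    tendsto_nhds_unique_of_frequently_eq (tr.comp (tendsto_div_nhdsGT ha))
      ((logValve_tendsto_right h.le).comp (tendsto_div_nhdsGT ha)) (frequently_nhdsGT_of_ae hae)
  rw [logJump_eq_zero (hmid (by rw [el]; rfl) (by rw [er]; rfl))] at hK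
  exact lt_irrefl _ hK

theorem continuityDomain_RSv {a M : ℝ} (ha : 0 < a) (hM : 0 < M) :
    continuityDomain domV (RSv a M) = {d ∈ domV | closedJump a d.1 d.2 ≠ M} := by
  refine setEq_of_toState ha (fun d hd => hd.1) (fun d hd => hd.1) fun p q => ?_
  have hj : closedJump a (toState a p) (toState a q) = M ↔ logJump p q = M / a ^ 2 := by
    rw [closedJump_toState ha, eq_div_iff (by positivity), mul_comm]
  simp only [mem_ofPred_eq, mem_domV_toState, true_and, ne_eq, hj]
  exact ⟨fun h h' => notMem_continuityDomain ha hM h' h, mem_continuityDomain ha⟩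

end

end GasValve

theorem theorem1 (a M : ℝ) (ha : 0 < a) (hM : 0 < M) :
    -- (I) coherence domain
    GasValve.coherenceDomain GasValve.domV (GasValve.RSv a M) =
      GasValve.setA a M ∪ GasValve.setOO a M ∧
    -- (II) consistence domain
    (GasValve.consistenceDomain GasValve.domV (GasValve.RSv a M) =
        GasValve.setCN1 a M ∪ GasValve.setCN2 a M ∧
      GasValve.consistenceDomain GasValve.domV (GasValve.RSv a M) =
        GasValve.setCNO a M ∪ GasValve.setCNA a M) ∧
    -- (III) continuity domain
    GasValve.continuityDomain GasValve.domV (GasValve.RSv a M) =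
      {d ∈ GasValve.domV | GasValve.closedJump a d.1 d.2 ≠ M} ∧
    -- (IV) invariant domains
    (∀ u₀ ∈ GasValve.Omega, u₀.2 = 0 →
      GasValve.IsInvariantDomain GasValve.domV (GasValve.RSv a M) (GasValve.invRegion a u₀)) := by
  exact ⟨GasValve.coherenceDomain_RSv ha hM,
    ⟨GasValve.consistenceDomain_RSv_eq_CN1_union_CN2 ha,
      GasValve.consistenceDomain_RSv_eq_CNO_union_CNA ha hM⟩,
    GasValve.continuityDomain_RSv ha hM, fun _ _ h₀ => GasValve.isInvariantDomain_invRegion ha h₀⟩
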